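/- Fix a universe; "large" refers to categories (and sets) belonging to it, and $\mathbf{SET}$ is the category of large sets. Let $\mathcal M=(\mathcal M,I,\otimes)$ be a monoidal category, $\mathsf T=(T,e,m)$ a monoid object in $\mathcal M$ (a \emph{theory}), $\mathcal C$ a large category, and $\Phi$ a \emph{metamodel} of $\mathcal M$ in $\mathcal C$: a functor $\Phi\colon\mathcal M^{\mathrm{op}}\times\mathcal C^{\mathrm{op}}\times\mathcal C\to\mathbf{SET}$, written $(X,A,B)\mapsto\Phi_X(A,B)$, with elements $\overline\phi_A\in\Phi_I(A,A)$ and maps $\overline\phi_{X,Y}\colon\Phi_Y(B,D)\times\Phi_X(A,B)\to\Phi_{Y\otimes X}(A,D)$, (extra)natural in all variables, unital and associative. A \emph{model} is a pair $(A,\xi)$ with $A\in\mathcal C$, $\xi\in\Phi_T(A,A)$, $\Phi_e(\xi)=\overline\phi_A$ and $\Phi_m(\xi)=\overline\phi_{T,T}(\xi,\xi)$; a homomorphism $(A,\xi)\to(A',\xi')$ is $f\colon A\to A'$ in $\mathcal C$ with $\Phi_T(A,f)(\xi)=\Phi_T(f,A')(\xi')$. Let $\mathrm{Mod}(\mathsf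 T,(\mathcal C,\Phi))$ be the category of models, and $U$ its forgetful functor to $\mathcal C$. Let $\mathbb{PROF}$ be the pseudo double category of large categories, functors (vertical), profunctors $\mathcal A\nrightarrow\mathcal B$, i.e. functors $\mathcal B^{\mathrm{op}}\times\mathcal A\to\mathbf{SET}$ (horizontal, composed by coends), and natural transformations; $(-)^{\mathrm{op}}$ reverses the horizontal direction. For a monoidal category $\mathcal N$ let $\mathbb H\Sigma(\mathcal N)$ be the vertically discrete pseudo double category with one object, horizontal morphisms the objects of $\mathcal N$ ($X$ followed by $Y$ being $Y\otimes X$), and squares the morphisms of $\mathcal N$. The metamodel $\Phi$ is regarded as the lax double functor $\mathbb H\Sigma(\mathcal M^{\mathrm{op}})\to\mathbb{PROF}^{\mathrm{op}}$ that sends the object to $\mathcal C$ and $X$ to $\Phi_X$, with comparison squares $\mathcal C(A,B)\to\Phi_I(A,B)$ and $\int^{B}\Phi_Y(B,D)\times\Phi_X(A,B)\to\Phi_{Y\otimes X}(A,D)$ induced by $\overline\phi$. Let $\Delta_a$ be the category of finite ordinals and monotone maps with ordinal sum, and $\mathsf U$ its monoid object on the one-element ordinal $\mathbf 1$. For a lax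 double functor $F\colon\mathbb I\to\mathbb D$, a \emph{double cone} with apex $A$ is a vertical transformation to $F$ from the constant double functor at $A$. It is a \emph{double limit} if (1) every double cone with apex $A'$ factors through it by a unique vertical morphism $A'\to A$; and (2) for all double cones $c',c''$ with apexes $A',A''$, with induced $k'\colon A'\to A$ and $k''\colon A''\to A$, every horizontal $H\colon A'\nrightarrow A''$ and every modification $\theta$ bounded by $c'$, $c''$, the constant transformation at $H$ and the identity of $F$, there is a unique square $\sigma$ with top $H$, sides $k',k''$ and bottom the horizontal identity of $A$, such that each $\theta_i$ is the vertical composite of $\sigma$ and the horizontal identity square of the $i$-th leg. Then: (i) there is a strong monoidal functor $F\colon\Delta_a\to\mathcal M$ with $F(\mathsf U)\cong\mathsf T$ as monoid objects; (ii) for every strong monoidal functor $F\colon\Delta_a\to\mathcal M$ and every isomorphism of monoid objects $\epsilon\colon F(\mathsf U)\cong\mathsf T$, the composite lax double functor $$\mathbb H\Sigma(\Delta_a^{\mathrm{op}})\xrightarrow{\ \mathbb H\Sigma(F^{\mathrm{op}})\ }\mathbb H\Sigma(\mathcal M^{\mathrm{op}})\xrightarrow{\ \Phi\ }\mathbb{PROF}^{\mathrm{op}}$$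 has a double limit with apex $\mathrm{Mod}(\mathsf T,(\mathcal C,\Phi))$, whose leg is $U$ and whose square at $\mathbf 1$ sends $f\colon(A,\xi)\to(A',\xi')$ to $\Phi_{\epsilon}\big(\Phi_T(A,f)(\xi)\big)\in\Phi_{F(\mathbf 1)}(A,A')$. -/

import Mathlib

open CategoryTheory Opposite MonoidalCategory

universe w v u v₁ u₁ h₁ s₁ v₂ u₂ h₂ s₂ v₃ u₃ h₃ s₃

/-! ## Pseudo double categories -/

/-- A pseudo double category, strict in the vertical direction and weak in the horizontal one.
`Hor A B` is the type of horizontal morphisms from `A` to `B`; `Sq X X' f g` is the type of squares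
with top `X`, bottom `X'`, left side `f` and right side `g`. Composites are written in
diagrammatic order: `hcomp X Y` is "first `X`, then `Y`". Equations between squares whose sides
agree only up to the laws of the vertical category are stated with `HEq`. -/
structure PseudoDoubleCategory where
  Obj : Type u₁
  [vert : Category.{v₁} Obj]
  Hor : Obj → Obj → Type h₁
  Sq {A B A' B' : Obj} (X : Hor A B) (X' : Hor A' B') (f : A ⟶ A') (g : B ⟶ B') : Type s₁
  /-- vertical identity squares -/
  vid {A B : Obj} (X : Hor A B) : Sq X X (𝟙 A) (𝟙 B)
  /-- vertical composition of squares -/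
  vcomp {A B A' B' A'' B'' : Obj} {X : Hor A B} {X' : Hor A' B'} {X'' : Hor A'' B''}
    {f : A ⟶ A'} {g : B ⟶ B'} {f' : A' ⟶ A''} {g' : B' ⟶ B''}
    (α : Sq X X' f g) (α' : Sq X' X'' f' g') : Sq X X'' (f ≫ f') (g ≫ g')
  vid_vcomp {A B A' B' : Obj} {X : Hor A B} {X' : Hor A' B'} {f : A ⟶ A'} {g : B ⟶ B'}
    (α : Sq X X' f g) : HEq (vcomp (vid X) α) α
  vcomp_vid {A B A' B' : Obj} {X : Hor A B} {X' : Hor A' B'} {f : A ⟶ A'} {g : B ⟶ B'}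
    (α : Sq X X' f g) : HEq (vcomp α (vid X')) α
  vcomp_assoc {A B A' B' A'' B'' A₃ B₃ : Obj} {X : Hor A B} {X' : Hor A' B'} {X'' : Hor A'' B''}
    {X₃ : Hor A₃ B₃} {f : A ⟶ A'} {g : B ⟶ B'} {f' : A' ⟶ A''} {g' : B' ⟶ B''}
    {f'' : A'' ⟶ A₃} {g'' : B'' ⟶ B₃}
    (α : Sq X X' f g) (α' : Sq X' X'' f' g') (α'' : Sq X'' X₃ f'' g'') :
    HEq (vcomp (vcomp α α') α'') (vcomp α (vcomp α' α''))
  /-- horizontal identities and horizontal composition -/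
  hid (A : Obj) : Hor A A
  hcomp {A B C : Obj} (X : Hor A B) (Y : Hor B C) : Hor A C
  hidSq {A A' : Obj} (f : A ⟶ A') : Sq (hid A) (hid A') f f
  hcompSq {A B C A' B' C' : Obj} {X : Hor A B} {Y : Hor B C} {X' : Hor A' B'} {Y' : Hor B' C'}
    {f : A ⟶ A'} {g : B ⟶ B'} {k : C ⟶ C'} (α : Sq X X' f g) (β : Sq Y Y' g k) :
    Sq (hcomp X Y) (hcomp X' Y') f k
  hidSq_id (A : Obj) : hidSq (𝟙 A) = vid (hid A)
  hidSq_comp {A A' A'' : Obj} (f : A ⟶ A') (f' : A' ⟶ A'') :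
    hidSq (f ≫ f') = vcomp (hidSq f) (hidSq f')
  hcompSq_vid {A B C : Obj} (X : Hor A B) (Y : Hor B C) :
    hcompSq (vid X) (vid Y) = vid (hcomp X Y)
  interchange {A B C A' B' C' A'' B'' C'' : Obj} {X : Hor A B} {Y : Hor B C} {X' : Hor A' B'}
    {Y' : Hor B' C'} {X'' : Hor A'' B''} {Y'' : Hor B'' C''}
    {f : A ⟶ A'} {g : B ⟶ B'} {k : C ⟶ C'} {f' : A' ⟶ A''} {g' : B' ⟶ B''} {k' : C' ⟶ C''}
    (α : Sq X X' f g) (β : Sq Y Y' g k) (α' : Sq X' X'' f' g') (β' : Sq Y' Y'' g' k') :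
    hcompSq (vcomp α α') (vcomp β β') = vcomp (hcompSq α β) (hcompSq α' β')
  /-- the left unitor, the right unitor and the associator, each with its inverse -/
  lu {A B : Obj} (X : Hor A B) : Sq (hcomp (hid A) X) X (𝟙 A) (𝟙 B)
  luInv {A B : Obj} (X : Hor A B) : Sq X (hcomp (hid A) X) (𝟙 A) (𝟙 B)
  ru {A B : Obj} (X : Hor A B) : Sq (hcomp X (hid B)) X (𝟙 A) (𝟙 B)
  ruInv {A B : Obj} (X : Hor A B) : Sq X (hcomp X (hid B)) (𝟙 A) (𝟙 B)
  assoc {A B C D : Obj} (X : Hor A B) (Y : Hor B C) (Z : Hor C D) :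
    Sq (hcomp (hcomp X Y) Z) (hcomp X (hcomp Y Z)) (𝟙 A) (𝟙 D)
  assocInv {A B C D : Obj} (X : Hor A B) (Y : Hor B C) (Z : Hor C D) :
    Sq (hcomp X (hcomp Y Z)) (hcomp (hcomp X Y) Z) (𝟙 A) (𝟙 D)
  lu_luInv {A B : Obj} (X : Hor A B) : HEq (vcomp (lu X) (luInv X)) (vid (hcomp (hid A) X))
  luInv_lu {A B : Obj} (X : Hor A B) : HEq (vcomp (luInv X) (lu X)) (vid X)
  ru_ruInv {A B : Obj} (X : Hor A B) : HEq (vcomp (ru X) (ruInv X)) (vid (hcomp X (hid B)))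
  ruInv_ru {A B : Obj} (X : Hor A B) : HEq (vcomp (ruInv X) (ru X)) (vid X)
  assoc_assocInv {A B C D : Obj} (X : Hor A B) (Y : Hor B C) (Z : Hor C D) :
    HEq (vcomp (assoc X Y Z) (assocInv X Y Z)) (vid (hcomp (hcomp X Y) Z))
  assocInv_assoc {A B C D : Obj} (X : Hor A B) (Y : Hor B C) (Z : Hor C D) :
    HEq (vcomp (assocInv X Y Z) (assoc X Y Z)) (vid (hcomp X (hcomp Y Z)))
  lu_naturality {A B A' B' : Obj} {X : Hor A B} {X' : Hor A' B'} {f : A ⟶ A'} {g : B ⟶ B'}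
    (α : Sq X X' f g) : HEq (vcomp (lu X) α) (vcomp (hcompSq (hidSq f) α) (lu X'))
  ru_naturality {A B A' B' : Obj} {X : Hor A B} {X' : Hor A' B'} {f : A ⟶ A'} {g : B ⟶ B'}
    (α : Sq X X' f g) : HEq (vcomp (ru X) α) (vcomp (hcompSq α (hidSq g)) (ru X'))
  assoc_naturality {A B C D A' B' C' D' : Obj} {X : Hor A B} {Y : Hor B C} {Z : Hor C D}
    {X' : Hor A' B'} {Y' : Hor B' C'} {Z' : Hor C' D'}
    {f : A ⟶ A'} {g : B ⟶ B'} {k : C ⟶ C'} {l : D ⟶ D'}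
    (α : Sq X X' f g) (β : Sq Y Y' g k) (γ : Sq Z Z' k l) :
    HEq (vcomp (assoc X Y Z) (hcompSq α (hcompSq β γ)))
      (vcomp (hcompSq (hcompSq α β) γ) (assoc X' Y' Z'))
  triangle {A B C : Obj} (X : Hor A B) (Y : Hor B C) :
    HEq (vcomp (assoc X (hid B) Y) (hcompSq (vid X) (lu Y))) (hcompSq (ru X) (vid Y))
  pentagon {A B C D E : Obj} (X : Hor A B) (Y : Hor B C) (Z : Hor C D) (W : Hor D E) :
    HEq (vcomp (assoc (hcomp X Y) Z W) (assoc X Y (hcomp Z W)))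
      (vcomp (vcomp (hcompSq (assoc X Y Z) (vid W)) (assoc X (hcomp Y Z) W))
        (hcompSq (vid X) (assoc Y Z W)))

attribute [instance] PseudoDoubleCategory.vert

namespace PseudoDoubleCategory

/-- The category of horizontal morphisms and squares under vertical composition. -/
structure Tot (D : PseudoDoubleCategory.{v₁, u₁, h₁, s₁}) where
  {src : D.Obj}
  {tgt : D.Obj}
  hor : D.Hor src tgt

/-- A square together with its left and right sides. -/
@[ext]
structure TotHom {D : PseudoDoubleCategory.{v₁, u₁, h₁, s₁}} (X Y : D.Tot) where
  {left : X.src ⟶ Y.src}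
  {right : X.tgt ⟶ Y.tgt}
  sq : D.Sq X.hor Y.hor left right

instance (D : PseudoDoubleCategory.{v₁, u₁, h₁, s₁}) : Category D.Tot where
  Hom X Y := TotHom X Y
  id X := ⟨D.vid X.hor⟩
  comp α β := ⟨D.vcomp α.sq β.sq⟩
  id_comp α := TotHom.ext (Category.id_comp _) (Category.id_comp _) (D.vid_vcomp _)
  comp_id α := TotHom.ext (Category.comp_id _) (Category.comp_id _) (D.vcomp_vid _)
  assoc α β γ := TotHom.ext (Category.assoc _ _ _) (Category.assoc _ _ _) (D.vcomp_assoc _ _ _)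

theorem heq_of_tot {D : PseudoDoubleCategory.{v₁, u₁, h₁, s₁}} {X Y : D.Tot} {α β : X ⟶ Y}
    (e : α = β) : HEq (TotHom.sq α) (TotHom.sq β) := by
  rw [e]

/-- The squares `a` and `a'` with identity sides are mutually inverse. -/
def totIso {D : PseudoDoubleCategory.{v₁, u₁, h₁, s₁}} {A B : D.Obj} {X Y : D.Hor A B}
    (a : D.Sq X Y (𝟙 A) (𝟙 B)) (a' : D.Sq Y X (𝟙 A) (𝟙 B))
    (e : HEq (D.vcomp a a') (D.vid X)) (e' : HEq (D.vcomp a' a) (D.vid Y)) :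
    (⟨X⟩ : D.Tot) ≅ ⟨Y⟩ where
  hom := ⟨a⟩
  inv := ⟨a'⟩
  hom_inv_id := TotHom.ext (Category.id_comp _) (Category.id_comp _) e
  inv_hom_id := TotHom.ext (Category.id_comp _) (Category.id_comp _) e'

theorem hcompSq_congr (D : PseudoDoubleCategory.{v₁, u₁, h₁, s₁}) {A B C A' B' C' : D.Obj}
    {X : D.Hor A B} {Y : D.Hor B C} {X' : D.Hor A' B'} {Y' : D.Hor B' C'}
    {f f₁ : A ⟶ A'} {g g₁ : B ⟶ B'} {k k₁ : C ⟶ C'}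
    {α : D.Sq X X' f g} {β : D.Sq Y Y' g k} {α₁ : D.Sq X X' f₁ g₁} {β₁ : D.Sq Y Y' g₁ k₁}
    (hf : f = f₁) (hg : g = g₁) (hk : k = k₁) (hα : HEq α α₁) (hβ : HEq β β₁) :
    HEq (D.hcompSq α β) (D.hcompSq α₁ β₁) := by
  subst hf hg hk
  rw [eq_of_heq hα, eq_of_heq hβ]

theorem hcompSq_inverse (D : PseudoDoubleCategory.{v₁, u₁, h₁, s₁}) {A B C : D.Obj}
    {X X' : D.Hor A B} {Y Y' : D.Hor B C}
    {a : D.Sq X X' (𝟙 A) (𝟙 B)} {a' : D.Sq X' X (𝟙 A) (𝟙 B)}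
    {b : D.Sq Y Y' (𝟙 B) (𝟙 C)} {b' : D.Sq Y' Y (𝟙 B) (𝟙 C)}
    (ha : HEq (D.vcomp a a') (D.vid X)) (hb : HEq (D.vcomp b b') (D.vid Y)) :
    HEq (D.vcomp (D.hcompSq a b) (D.hcompSq a' b')) (D.vid (D.hcomp X Y)) := by
  rw [← D.interchange, ← D.hcompSq_vid]
  exact D.hcompSq_congr (Category.id_comp _) (Category.id_comp _) (Category.id_comp _) ha hb

/-- The associator as an isomorphism. -/
def assocIso (D : PseudoDoubleCategory.{v₁, u₁, h₁, s₁}) {A B C E : D.Obj} (X : D.Hor A B)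
    (Y : D.Hor B C) (Z : D.Hor C E) :
    (⟨D.hcomp (D.hcomp X Y) Z⟩ : D.Tot) ≅ ⟨D.hcomp X (D.hcomp Y Z)⟩ :=
  totIso _ _ (D.assoc_assocInv X Y Z) (D.assocInv_assoc X Y Z)

/-- The pseudo double category obtained by reversing the horizontal direction. -/
def hop (D : PseudoDoubleCategory.{v₁, u₁, h₁, s₁}) : PseudoDoubleCategory.{v₁, u₁, h₁, s₁} where
  Obj := D.Obj
  vert := D.vert
  Hor A B := D.Hor B A
  Sq X X' f g := D.Sq X X' g f
  vid X := D.vid X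
  vcomp α α' := D.vcomp α α'
  vid_vcomp α := D.vid_vcomp α
  vcomp_vid α := D.vcomp_vid α
  vcomp_assoc α α' α'' := D.vcomp_assoc α α' α''
  hid A := D.hid A
  hcomp X Y := D.hcomp Y X
  hidSq f := D.hidSq f
  hcompSq α β := D.hcompSq β α
  hidSq_id A := D.hidSq_id A
  hidSq_comp f f' := D.hidSq_comp f f'
  hcompSq_vid X Y := D.hcompSq_vid Y X
  interchange α β α' β' := D.interchange β α β' α'
  lu X := D.ru X
  luInv X := D.ruInv X
  ru X := D.lu X
  ruInv X := D.luInv X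
  assoc X Y Z := D.assocInv Z Y X
  assocInv X Y Z := D.assoc Z Y X
  lu_luInv X := D.ru_ruInv X
  luInv_lu X := D.ruInv_ru X
  ru_ruInv X := D.lu_luInv X
  ruInv_ru X := D.luInv_lu X
  assoc_assocInv X Y Z := D.assocInv_assoc Z Y X
  assocInv_assoc X Y Z := D.assoc_assocInv Z Y X
  lu_naturality α := D.ru_naturality α
  ru_naturality α := D.lu_naturality α
  assoc_naturality {A B C E A' B' C' E' X Y Z X' Y' Z' f g k l} α β γ := by
    have e : (D.assocIso Z Y X).hom ≫ (⟨D.hcompSq γ (D.hcompSq β α)⟩ : TotHom _ _) =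
        (⟨D.hcompSq (D.hcompSq γ β) α⟩ : TotHom _ _) ≫ (D.assocIso Z' Y' X').hom :=
      TotHom.ext ((Category.id_comp _).trans (Category.comp_id _).symm)
        ((Category.id_comp _).trans (Category.comp_id _).symm) (D.assoc_naturality γ β α)
    exact heq_of_tot ((Iso.inv_comp_eq _).mpr (((Iso.eq_comp_inv _).mpr
      (e.symm.trans rfl)).trans (Category.assoc _ _ _)))
  triangle {A B C} X Y := by
    have e : (D.assocIso Y (D.hid B) X).hom ≫ (⟨D.hcompSq (D.vid Y) (D.lu X)⟩ : TotHom _ _) =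
        (⟨D.hcompSq (D.ru Y) (D.vid X)⟩ : TotHom _ ⟨D.hcomp Y X⟩) :=
      TotHom.ext (Category.id_comp _) (Category.id_comp _) (D.triangle Y X)
    exact heq_of_tot ((Iso.inv_comp_eq _).mpr e.symm)
  pentagon {A B C E F} X Y Z W := by
    let a := totIso _ _ (D.hcompSq_inverse (D.assoc_assocInv W Z Y) (D.vcomp_vid (D.vid X)))
      (D.hcompSq_inverse (D.assocInv_assoc W Z Y) (D.vcomp_vid (D.vid X)))
    let b := totIso _ _ (D.hcompSq_inverse (D.vcomp_vid (D.vid W)) (D.assoc_assocInv Z Y X))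
      (D.hcompSq_inverse (D.vcomp_vid (D.vid W)) (D.assocInv_assoc Z Y X))
    have e : D.assocIso (D.hcomp W Z) Y X ≪≫ D.assocIso W Z (D.hcomp Y X) =
        (a ≪≫ D.assocIso W (D.hcomp Z Y) X) ≪≫ b :=
      Iso.ext (TotHom.ext (congrArg (· ≫ 𝟙 _) (Category.id_comp (𝟙 _))).symm
        (congrArg (· ≫ 𝟙 _) (Category.id_comp (𝟙 _))).symm (D.pentagon W Z Y X))
    exact heq_of_tot ((congrArg Iso.inv e).trans (Category.assoc _ _ _).symm)

end PseudoDoubleCategory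

/-! ## Lax double functors -/

/-- A lax double functor: strictly functorial vertically, and horizontally functorial up to the
comparison squares `unit` and `comp`. -/
structure LaxDoubleFunctor (D : PseudoDoubleCategory.{v₁, u₁, h₁, s₁})
    (E : PseudoDoubleCategory.{v₂, u₂, h₂, s₂}) where
  vert : D.Obj ⥤ E.Obj
  hor {A B : D.Obj} (X : D.Hor A B) : E.Hor (vert.obj A) (vert.obj B)
  sq {A B A' B' : D.Obj} {X : D.Hor A B} {X' : D.Hor A' B'} {f : A ⟶ A'} {g : B ⟶ B'}
    (α : D.Sq X X' f g) : E.Sq (hor X) (hor X') (vert.map f) (vert.map g)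
  sq_vid {A B : D.Obj} (X : D.Hor A B) : HEq (sq (D.vid X)) (E.vid (hor X))
  sq_vcomp {A B A' B' A'' B'' : D.Obj} {X : D.Hor A B} {X' : D.Hor A' B'} {X'' : D.Hor A'' B''}
    {f : A ⟶ A'} {g : B ⟶ B'} {f' : A' ⟶ A''} {g' : B' ⟶ B''}
    (α : D.Sq X X' f g) (α' : D.Sq X' X'' f' g') :
    HEq (sq (D.vcomp α α')) (E.vcomp (sq α) (sq α'))
  unit (A : D.Obj) : E.Sq (E.hid (vert.obj A)) (hor (D.hid A)) (𝟙 _) (𝟙 _)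
  comp {A B C : D.Obj} (X : D.Hor A B) (Y : D.Hor B C) :
    E.Sq (E.hcomp (hor X) (hor Y)) (hor (D.hcomp X Y)) (𝟙 _) (𝟙 _)
  unit_naturality {A A' : D.Obj} (f : A ⟶ A') :
    HEq (E.vcomp (E.hidSq (vert.map f)) (unit A')) (E.vcomp (unit A) (sq (D.hidSq f)))
  comp_naturality {A B C A' B' C' : D.Obj} {X : D.Hor A B} {Y : D.Hor B C} {X' : D.Hor A' B'}
    {Y' : D.Hor B' C'} {f : A ⟶ A'} {g : B ⟶ B'} {k : C ⟶ C'}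
    (α : D.Sq X X' f g) (β : D.Sq Y Y' g k) :
    HEq (E.vcomp (E.hcompSq (sq α) (sq β)) (comp X' Y'))
      (E.vcomp (comp X Y) (sq (D.hcompSq α β)))
  left_unitality {A B : D.Obj} (X : D.Hor A B) :
    HEq (E.vcomp (E.vcomp (E.hcompSq (unit A) (E.vid (hor X))) (comp (D.hid A) X)) (sq (D.lu X)))
      (E.lu (hor X))
  right_unitality {A B : D.Obj} (X : D.Hor A B) :
    HEq (E.vcomp (E.vcomp (E.hcompSq (E.vid (hor X)) (unit B)) (comp X (D.hid B))) (sq (D.ru X)))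
      (E.ru (hor X))
  associativity {A B C A' : D.Obj} (X : D.Hor A B) (Y : D.Hor B C) (Z : D.Hor C A') :
    HEq (E.vcomp (E.vcomp (E.hcompSq (comp X Y) (E.vid (hor Z))) (comp (D.hcomp X Y) Z))
        (sq (D.assoc X Y Z)))
      (E.vcomp (E.vcomp (E.assoc (hor X) (hor Y) (hor Z)) (E.hcompSq (E.vid (hor X)) (comp Y Z)))
        (comp X (D.hcomp Y Z)))

namespace PseudoDoubleCategory

/-- Transport of a square along equalities between its sides. -/
def castSq (D : PseudoDoubleCategory.{v₁, u₁, h₁, s₁}) {A B A' B' : D.Obj} {X : D.Hor A B}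
    {X' : D.Hor A' B'} {f f' : A ⟶ A'} {g g' : B ⟶ B'} (hf : f = f') (hg : g = g')
    (α : D.Sq X X' f g) : D.Sq X X' f' g' :=
  hf ▸ hg ▸ α

theorem castSq_heq (D : PseudoDoubleCategory.{v₁, u₁, h₁, s₁}) {A B A' B' : D.Obj} {X : D.Hor A B}
    {X' : D.Hor A' B'} {f f' : A ⟶ A'} {g g' : B ⟶ B'} (hf : f = f') (hg : g = g')
    (α : D.Sq X X' f g) : HEq (D.castSq hf hg α) α := by
  subst hf hg
  rfl

/-- A square as a morphism of `Tot`. -/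
abbrev tot (D : PseudoDoubleCategory.{v₁, u₁, h₁, s₁}) {A B A' B' : D.Obj} {X : D.Hor A B}
    {X' : D.Hor A' B'} {f : A ⟶ A'} {g : B ⟶ B'} (α : D.Sq X X' f g) :
    (⟨X⟩ : D.Tot) ⟶ ⟨X'⟩ :=
  TotHom.mk α

theorem tot_castSq (D : PseudoDoubleCategory.{v₁, u₁, h₁, s₁}) {A B A' B' : D.Obj} {X : D.Hor A B}
    {X' : D.Hor A' B'} {f f' : A ⟶ A'} {g g' : B ⟶ B'} (hf : f = f') (hg : g = g')
    (α : D.Sq X X' f g) : D.tot (D.castSq hf hg α) = D.tot α := by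
  subst hf hg
  rfl

theorem tot_vcomp (D : PseudoDoubleCategory.{v₁, u₁, h₁, s₁}) {A B A' B' A'' B'' : D.Obj}
    {X : D.Hor A B} {X' : D.Hor A' B'} {X'' : D.Hor A'' B''}
    {f : A ⟶ A'} {g : B ⟶ B'} {f' : A' ⟶ A''} {g' : B' ⟶ B''}
    (α : D.Sq X X' f g) (α' : D.Sq X' X'' f' g') :
    D.tot (D.vcomp α α') = D.tot α ≫ D.tot α' := rfl

theorem tot_eq (D : PseudoDoubleCategory.{v₁, u₁, h₁, s₁}) {A B A' B' : D.Obj} {X : D.Hor A B}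
    {X' : D.Hor A' B'} {f f' : A ⟶ A'} {g g' : B ⟶ B'} (hf : f = f') (hg : g = g')
    {α : D.Sq X X' f g} {β : D.Sq X X' f' g'} (e : HEq α β) : D.tot α = D.tot β :=
  TotHom.ext hf hg e

theorem heq_of_tot_eq (D : PseudoDoubleCategory.{v₁, u₁, h₁, s₁}) {A B A' B' : D.Obj}
    {X : D.Hor A B} {X' : D.Hor A' B'} {f f' : A ⟶ A'} {g g' : B ⟶ B'}
    {α : D.Sq X X' f g} {β : D.Sq X X' f' g'} (e : D.tot α = D.tot β) : HEq α β :=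
  heq_of_tot e

/-- Horizontal composition of squares, read in `Tot`. -/
theorem tot_hcompSq_congr (D : PseudoDoubleCategory.{v₁, u₁, h₁, s₁}) {A B C A' B' C' : D.Obj}
    {X : D.Hor A B} {Y : D.Hor B C} {X' : D.Hor A' B'} {Y' : D.Hor B' C'}
    {f f₁ : A ⟶ A'} {g g₁ : B ⟶ B'} {k k₁ : C ⟶ C'}
    {α : D.Sq X X' f g} {β : D.Sq Y Y' g k} {α₁ : D.Sq X X' f₁ g₁} {β₁ : D.Sq Y Y' g₁ k₁}
    (hα : D.tot α = D.tot α₁) (hβ : D.tot β = D.tot β₁) :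
    D.tot (D.hcompSq α β) = D.tot (D.hcompSq α₁ β₁) := by
  have e₁ : f = f₁ := congrArg TotHom.left hα
  have e₂ : g = g₁ := congrArg TotHom.right hα
  have e₃ : k = k₁ := congrArg TotHom.right hβ
  exact D.tot_eq e₁ e₃ (D.hcompSq_congr e₁ e₂ e₃ (heq_of_tot hα) (heq_of_tot hβ))

end PseudoDoubleCategory

namespace LaxDoubleFunctor

variable {D : PseudoDoubleCategory.{v₁, u₁, h₁, s₁}} {E : PseudoDoubleCategory.{v₂, u₂, h₂, s₂}}
  {K : PseudoDoubleCategory.{v₃, u₃, h₃, s₃}}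

/-- The functor on horizontal morphisms and squares underlying a lax double functor. -/
def totFunctor (F : LaxDoubleFunctor D E) : D.Tot ⥤ E.Tot where
  obj X := ⟨F.hor X.hor⟩
  map α := ⟨F.sq (PseudoDoubleCategory.TotHom.sq α)⟩
  map_id X := E.tot_eq (F.vert.map_id _) (F.vert.map_id _) (F.sq_vid X.hor)
  map_comp α β := E.tot_eq (F.vert.map_comp _ _) (F.vert.map_comp _ _) (F.sq_vcomp _ _)

theorem tot_sq_vcomp (G : LaxDoubleFunctor E K) {A B A' B' A'' B'' : E.Obj}
    {X : E.Hor A B} {X' : E.Hor A' B'} {X'' : E.Hor A'' B''}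
    {f : A ⟶ A'} {g : B ⟶ B'} {f' : A' ⟶ A''} {g' : B' ⟶ B''}
    (α : E.Sq X X' f g) (α' : E.Sq X' X'' f' g') :
    K.tot (G.sq (E.vcomp α α')) = K.tot (G.sq α) ≫ K.tot (G.sq α') :=
  G.totFunctor.map_comp (E.tot α) (E.tot α')

theorem tot_sq_vid (G : LaxDoubleFunctor E K) {A B : E.Obj} (X : E.Hor A B) :
    K.tot (G.sq (E.vid X)) = 𝟙 _ :=
  G.totFunctor.map_id ⟨X⟩

theorem tot_sq_congr (G : LaxDoubleFunctor E K) {A B A' B' : E.Obj} {X : E.Hor A B}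
    {X' : E.Hor A' B'} {f f' : A ⟶ A'} {g g' : B ⟶ B'}
    {α : E.Sq X X' f g} {β : E.Sq X X' f' g'} (e : E.tot α = E.tot β) :
    K.tot (G.sq α) = K.tot (G.sq β) :=
  congrArg G.totFunctor.map e

theorem tot_comp_naturality (G : LaxDoubleFunctor E K) {A B C A' B' C' : E.Obj}
    {X : E.Hor A B} {Y : E.Hor B C} {X' : E.Hor A' B'}
    {Y' : E.Hor B' C'} {f : A ⟶ A'} {g : B ⟶ B'} {k : C ⟶ C'}
    (α : E.Sq X X' f g) (β : E.Sq Y Y' g k) :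
    K.tot (K.hcompSq (G.sq α) (G.sq β)) ≫ K.tot (G.comp X' Y') =
      K.tot (G.comp X Y) ≫ K.tot (G.sq (E.hcompSq α β)) :=
  K.tot_eq (by simp) (by simp) (G.comp_naturality α β)

/-- The composite of lax double functors. -/
def trans (F : LaxDoubleFunctor D E) (G : LaxDoubleFunctor E K) : LaxDoubleFunctor D K where
  vert := F.vert ⋙ G.vert
  hor X := G.hor (F.hor X)
  sq α := G.sq (F.sq α)
  sq_vid X := K.heq_of_tot_eq (by
    have := congrArg G.totFunctor.map (F.totFunctor.map_id ⟨X⟩)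
    exact this.trans (G.totFunctor.map_id _))
  sq_vcomp α α' := K.heq_of_tot_eq (by
    have := congrArg G.totFunctor.map (F.totFunctor.map_comp (D.tot α) (D.tot α'))
    exact this.trans (G.totFunctor.map_comp _ _))
  unit A := K.castSq ((Category.id_comp _).trans (G.vert.map_id _))
    ((Category.id_comp _).trans (G.vert.map_id _))
    (K.vcomp (G.unit (F.vert.obj A)) (G.sq (F.unit A)))
  comp X Y := K.castSq ((Category.id_comp _).trans (G.vert.map_id _))
    ((Category.id_comp _).trans (G.vert.map_id _))
    (K.vcomp (G.comp (F.hor X) (F.hor Y)) (G.sq (F.comp X Y)))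
  unit_naturality {A A'} f := K.heq_of_tot_eq (by
    have e₁ : K.tot (K.hidSq (G.vert.map (F.vert.map f))) ≫ K.tot (G.unit (F.vert.obj A')) =
        K.tot (G.unit (F.vert.obj A)) ≫ K.tot (G.sq (E.hidSq (F.vert.map f))) :=
      K.tot_eq (by simp) (by simp) (G.unit_naturality (F.vert.map f))
    have e₂ := G.tot_sq_congr (E.tot_eq (by simp) (by simp) (F.unit_naturality f))
    rw [tot_sq_vcomp, tot_sq_vcomp] at e₂
    simp only [PseudoDoubleCategory.tot_vcomp, PseudoDoubleCategory.tot_castSq, Functor.comp_map,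
      Category.assoc]
    rw [← e₂, reassoc_of% e₁])
  comp_naturality {A B C A' B' C' X Y X' Y' f g k} α β := K.heq_of_tot_eq (by
    have e₂ := G.tot_sq_congr (E.tot_eq (by simp) (by simp) (F.comp_naturality α β))
    rw [tot_sq_vcomp, tot_sq_vcomp] at e₂
    simp only [PseudoDoubleCategory.tot_vcomp, PseudoDoubleCategory.tot_castSq, Functor.comp_map,
      Category.assoc]
    rw [← e₂, ← Category.assoc, G.tot_comp_naturality, Category.assoc])
  left_unitality {A B} X := K.heq_of_tot_eq (by
    have e₂ := G.tot_sq_congr (E.tot_eq (by simp) (by simp) (F.left_unitality X))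
    rw [tot_sq_vcomp, tot_sq_vcomp, Category.assoc] at e₂
    have e₃ : K.tot (K.vcomp (K.vcomp (K.hcompSq (G.unit (F.vert.obj A)) (K.vid (G.hor (F.hor X))))
        (G.comp (E.hid (F.vert.obj A)) (F.hor X))) (G.sq (E.lu (F.hor X)))) =
        K.tot (K.lu (G.hor (F.hor X))) :=
      K.tot_eq (by simp) (by simp) (G.left_unitality (F.hor X))
    have e₄ := K.tot_hcompSq_congr
      (K.tot_castSq ((Category.id_comp _).trans (G.vert.map_id _))
        ((Category.id_comp _).trans (G.vert.map_id _))
        (K.vcomp (G.unit (F.vert.obj A)) (G.sq (F.unit A))))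
      (show K.tot (K.vid (G.hor (F.hor X))) =
        K.tot (K.vcomp (K.vid (G.hor (F.hor X))) (G.sq (E.vid (F.hor X)))) by
          rw [K.tot_vcomp, tot_sq_vid, Category.comp_id])
    rw [K.interchange, K.tot_vcomp] at e₄
    simp only [PseudoDoubleCategory.tot_vcomp, PseudoDoubleCategory.tot_castSq,
      Category.assoc] at e₃ e₄ ⊢
    rw [e₄, Category.assoc, ← Category.assoc (K.tot (K.hcompSq (G.sq _) (G.sq _))),
      G.tot_comp_naturality, Category.assoc, e₂, e₃])
  right_unitality {A B} X := K.heq_of_tot_eq (by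
    have e₂ := G.tot_sq_congr (E.tot_eq (by simp) (by simp) (F.right_unitality X))
    rw [tot_sq_vcomp, tot_sq_vcomp, Category.assoc] at e₂
    have e₃ : K.tot (K.vcomp (K.vcomp (K.hcompSq (K.vid (G.hor (F.hor X))) (G.unit (F.vert.obj B)))
        (G.comp (F.hor X) (E.hid (F.vert.obj B)))) (G.sq (E.ru (F.hor X)))) =
        K.tot (K.ru (G.hor (F.hor X))) :=
      K.tot_eq (by simp) (by simp) (G.right_unitality (F.hor X))
    have e₄ := K.tot_hcompSq_congr
      (show K.tot (K.vid (G.hor (F.hor X))) =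
        K.tot (K.vcomp (K.vid (G.hor (F.hor X))) (G.sq (E.vid (F.hor X)))) by
          rw [K.tot_vcomp, tot_sq_vid, Category.comp_id])
      (K.tot_castSq ((Category.id_comp _).trans (G.vert.map_id _))
        ((Category.id_comp _).trans (G.vert.map_id _))
        (K.vcomp (G.unit (F.vert.obj B)) (G.sq (F.unit B))))
    rw [K.interchange, K.tot_vcomp] at e₄
    simp only [PseudoDoubleCategory.tot_vcomp, PseudoDoubleCategory.tot_castSq,
      Category.assoc] at e₃ e₄ ⊢
    rw [e₄, Category.assoc, ← Category.assoc (K.tot (K.hcompSq (G.sq _) (G.sq _))),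
      G.tot_comp_naturality, Category.assoc, e₂, e₃])
  associativity {A B C A'} X Y Z := K.heq_of_tot_eq (by
    have e₂ := G.tot_sq_congr (E.tot_eq (by simp) (by simp) (F.associativity X Y Z))
    rw [tot_sq_vcomp, tot_sq_vcomp, tot_sq_vcomp, tot_sq_vcomp, Category.assoc,
      Category.assoc] at e₂
    have e₃ := K.tot_eq (by simp) (by simp) (G.associativity (F.hor X) (F.hor Y) (F.hor Z))
    have e₄ := K.tot_hcompSq_congr
      (K.tot_castSq ((Category.id_comp _).trans (G.vert.map_id _))
        ((Category.id_comp _).trans (G.vert.map_id _))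
        (K.vcomp (G.comp (F.hor X) (F.hor Y)) (G.sq (F.comp X Y))))
      (show K.tot (K.vid (G.hor (F.hor Z))) =
        K.tot (K.vcomp (K.vid (G.hor (F.hor Z))) (G.sq (E.vid (F.hor Z)))) by
          rw [K.tot_vcomp, tot_sq_vid, Category.comp_id])
    have e₅ := K.tot_hcompSq_congr
      (show K.tot (K.vid (G.hor (F.hor X))) =
        K.tot (K.vcomp (K.vid (G.hor (F.hor X))) (G.sq (E.vid (F.hor X)))) by
          rw [K.tot_vcomp, tot_sq_vid, Category.comp_id])
      (K.tot_castSq ((Category.id_comp _).trans (G.vert.map_id _))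
        ((Category.id_comp _).trans (G.vert.map_id _))
        (K.vcomp (G.comp (F.hor Y) (F.hor Z)) (G.sq (F.comp Y Z))))
    rw [K.interchange, K.tot_vcomp] at e₄ e₅
    simp only [PseudoDoubleCategory.tot_vcomp, PseudoDoubleCategory.tot_castSq,
      Category.assoc] at e₃ e₄ e₅ ⊢
    rw [e₄, e₅, Category.assoc, ← Category.assoc (K.tot (K.hcompSq (G.sq _) (G.sq _))),
      G.tot_comp_naturality, Category.assoc, e₂, reassoc_of% e₃, Category.assoc,
      ← Category.assoc (K.tot (K.hcompSq (G.sq _) (G.sq _))),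
      G.tot_comp_naturality, Category.assoc])

end LaxDoubleFunctor

/-! ## Double limits -/

/-- A vertical double cone with apex `A` over a lax double functor `F`: a vertical transformation
to `F` from the double functor constant at `A` (which sends every horizontal morphism to the
horizontal identity of `A`, with the unit isomorphism `I ⊗ I ≅ I` as comparison). -/
structure DoubleCone {D : PseudoDoubleCategory.{v₁, u₁, h₁, s₁}}
    {E : PseudoDoubleCategory.{v₂, u₂, h₂, s₂}} (F : LaxDoubleFunctor D E) (A : E.Obj) where
  leg (i : D.Obj) : A ⟶ F.vert.obj i
  cell {i j : D.Obj} (X : D.Hor i j) : E.Sq (E.hid A) (F.hor X) (leg i) (leg j)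
  leg_naturality {i j : D.Obj} (f : i ⟶ j) : leg i ≫ F.vert.map f = leg j
  cell_naturality {i j i' j' : D.Obj} {X : D.Hor i j} {X' : D.Hor i' j'} {f : i ⟶ i'}
    {g : j ⟶ j'} (α : D.Sq X X' f g) : HEq (E.vcomp (cell X) (F.sq α)) (cell X')
  cell_unit (i : D.Obj) : HEq (E.vcomp (E.hidSq (leg i)) (F.unit i)) (cell (D.hid i))
  cell_comp {i j k : D.Obj} (X : D.Hor i j) (Y : D.Hor j k) :
    HEq (E.vcomp (E.vcomp (E.luInv (E.hid A)) (E.hcompSq (cell X) (cell Y))) (F.comp X Y))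
      (cell (D.hcomp X Y))

namespace DoubleCone

variable {D : PseudoDoubleCategory.{v₁, u₁, h₁, s₁}} {E : PseudoDoubleCategory.{v₂, u₂, h₂, s₂}}
  {F : LaxDoubleFunctor D E} {A A' A'' : E.Obj}

/-- The double cone `c'` factors through the double cone `c` along the vertical morphism `k`. -/
structure Factors (c : DoubleCone F A) (c' : DoubleCone F A') (k : A' ⟶ A) : Prop where
  leg (i : D.Obj) : k ≫ c.leg i = c'.leg i
  cell {i j : D.Obj} (X : D.Hor i j) : HEq (E.vcomp (E.hidSq k) (c.cell X)) (c'.cell X)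

/-- A horizontal morphism of double cones with underlying horizontal morphism `H`: a modification
with top the horizontal transformation constant at `H`, bottom the identity transformation of `F`
and sides the two double cones. -/
structure HorMod (c' : DoubleCone F A') (c'' : DoubleCone F A'') (H : E.Hor A' A'') where
  app (i : D.Obj) : E.Sq H (E.hid (F.vert.obj i)) (c'.leg i) (c''.leg i)
  naturality {i j : D.Obj} (f : i ⟶ j) :
    HEq (E.vcomp (app i) (E.hidSq (F.vert.map f))) (app j)
  comm {i j : D.Obj} (X : D.Hor i j) :
    HEq (E.vcomp (E.vcomp (E.luInv H) (E.hcompSq (c'.cell X) (app j))) (E.ru (F.hor X)))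
      (E.vcomp (E.vcomp (E.ruInv H) (E.hcompSq (app i) (c''.cell X))) (E.lu (F.hor X)))

/-- The double cone `c` is a double limit of `F`: it has the one-dimensional universal property
with respect to vertical morphisms into the apex, and the two-dimensional one with respect to
squares into the horizontal identity of the apex. -/
structure IsDoubleLimit (c : DoubleCone F A) : Prop where
  existsUnique_lift {A' : E.Obj} (c' : DoubleCone F A') : ∃! k : A' ⟶ A, c.Factors c' k
  existsUnique_square {A' A'' : E.Obj} (c' : DoubleCone F A') (c'' : DoubleCone F A'')
    (k' : A' ⟶ A) (k'' : A'' ⟶ A) (hk' : c.Factors c' k') (hk'' : c.Factors c'' k'')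
    (H : E.Hor A' A'') (θ : HorMod c' c'' H) :
    ∃! σ : E.Sq H (E.hid A) k' k'', ∀ i : D.Obj,
      HEq (E.vcomp σ (E.hidSq (c.leg i))) (θ.app i)

end DoubleCone

/-! ## The pseudo double category of a monoidal category -/

section HSigma

variable {N : Type u₁} [Category.{v₁} N] [MonoidalCategory N]
  {N' : Type u₂} [Category.{v₂} N'] [MonoidalCategory N']

/-- The vertically discrete pseudo double category of the one-object bicategory of a monoidal
category `N`: horizontal morphisms are the objects of `N`, the horizontal composite of `X` followed
by `Y` is `Y ⊗ X`, and squares are the morphisms of `N`. -/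
def HSigma (N : Type u₁) [Category.{v₁} N] [MonoidalCategory N] :
    PseudoDoubleCategory.{0, 0, u₁, v₁} where
  Obj := Discrete PUnit.{1}
  Hor _ _ := N
  Sq X Y _ _ := X ⟶ Y
  vid X := 𝟙 X
  vcomp α β := α ≫ β
  vid_vcomp α := heq_of_eq (Category.id_comp α)
  vcomp_vid α := heq_of_eq (Category.comp_id α)
  vcomp_assoc α β γ := heq_of_eq (Category.assoc α β γ)
  hid _ := 𝟙_ N
  hcomp X Y := Y ⊗ X
  hidSq _ := 𝟙 _
  hcompSq α β := β ⊗ₘ α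
  hidSq_id _ := rfl
  hidSq_comp _ _ := (Category.comp_id _).symm
  hcompSq_vid X Y := by simp
  interchange α β α' β' := by simp
  lu X := (ρ_ X).hom
  luInv X := (ρ_ X).inv
  ru X := (λ_ X).hom
  ruInv X := (λ_ X).inv
  assoc X Y Z := (α_ Z Y X).inv
  assocInv X Y Z := (α_ Z Y X).hom
  lu_luInv X := by simp
  luInv_lu X := by simp
  ru_ruInv X := by simp
  ruInv_ru X := by simp
  assoc_assocInv X Y Z := by simp
  assocInv_assoc X Y Z := by simp
  lu_naturality α := by simp
  ru_naturality α := by simp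
  assoc_naturality α β γ := by simp
  triangle X Y := by simp
  pentagon X Y Z W := by simp

/-- The lax double functor induced by a lax monoidal functor. -/
def HSigma.map (G : N ⥤ N') [G.LaxMonoidal] : LaxDoubleFunctor (HSigma N) (HSigma N') where
  vert := 𝟭 _
  hor X := G.obj X
  sq α := G.map α
  sq_vid X := heq_of_eq (G.map_id X)
  sq_vcomp α β := heq_of_eq (G.map_comp α β)
  unit _ := Functor.LaxMonoidal.ε G
  comp X Y := Functor.LaxMonoidal.μ G Y X
  unit_naturality f := heq_of_eq (by simp [HSigma])
  comp_naturality α β := heq_of_eq (Functor.LaxMonoidal.μ_natural G β α)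
  left_unitality X := heq_of_eq (by
    simpa [HSigma] using (Functor.LaxMonoidal.right_unitality G X).symm)
  right_unitality X := heq_of_eq (by
    simpa [HSigma] using (Functor.LaxMonoidal.left_unitality G X).symm)
  associativity X Y Z := heq_of_eq (by
    simpa [HSigma] using Functor.LaxMonoidal.associativity_inv G Z Y X)

/-- The opposite of an oplax monoidal functor is lax monoidal. -/
instance opLaxMonoidal (G : N ⥤ N') [G.OplaxMonoidal] : G.op.LaxMonoidal where
  ε := (Functor.OplaxMonoidal.η G).op
  μ X Y := (Functor.OplaxMonoidal.δ G X.unop Y.unop).op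
  μ_natural_left f X := Quiver.Hom.unop_inj (by simp)
  μ_natural_right X f := Quiver.Hom.unop_inj (by simp)
  associativity X Y Z := Quiver.Hom.unop_inj (by simp)
  left_unitality X := Quiver.Hom.unop_inj (by simp)
  right_unitality X := Quiver.Hom.unop_inj (by simp)

end HSigma

/-! ## The pseudo double category of categories and profunctors -/

namespace CategoryTheory.Profunctor

section

variable {A B C D : Type w} [Category.{w} A] [Category.{w} B] [Category.{w} C] [Category.{w} D]

/-- The set `H(b, a)`, covariant in `a` and contravariant in `b`. -/
abbrev El (H : Profunctor.{w} A B) (b : B) (a : A) : Type w := (H.obj a).obj (op b)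

/-- The covariant action `H(b, f) : H(b, a) → H(b, a')`. -/
def cov (H : Profunctor.{w} A B) {a a' : A} (f : a ⟶ a') {b : B} (x : H.El b a) : H.El b a' :=
  (H.map f).app (op b) x

/-- The contravariant action `H(g, a) : H(b', a) → H(b, a)`. -/
def con (H : Profunctor.{w} A B) {b b' : B} (g : b ⟶ b') {a : A} (x : H.El b' a) : H.El b a :=
  (H.obj a).map g.op x

variable (H : Profunctor.{w} A B)

@[simp] theorem cov_id {a : A} {b : B} (x : H.El b a) : H.cov (𝟙 a) x = x := by simp [cov]

@[simp] theorem con_id {a : A} {b : B} (x : H.El b a) : H.con (𝟙 b) x = x := by simp [con]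

theorem cov_comp {a a' a'' : A} (f : a ⟶ a') (f' : a' ⟶ a'') {b : B} (x : H.El b a) :
    H.cov (f ≫ f') x = H.cov f' (H.cov f x) := by simp [cov]

theorem con_comp {b b' b'' : B} (g : b ⟶ b') (g' : b' ⟶ b'') {a : A} (x : H.El b'' a) :
    H.con (g ≫ g') x = H.con g (H.con g' x) := by simp [con]

theorem cov_con {a a' : A} (f : a ⟶ a') {b b' : B} (g : b ⟶ b') (x : H.El b' a) :
    H.cov f (H.con g x) = H.con g (H.cov f x) :=
  ConcreteCategory.congr_hom ((H.map f).naturality g.op) x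

/-- The component `H(b, a) → K(b, a)` of a natural transformation `t : H ⟶ K`. -/
def happ {H K : Profunctor.{w} A B} (t : H ⟶ K) {a : A} {b : B} (x : H.El b a) : K.El b a :=
  (t.app a).app (op b) x

theorem happ_id {a : A} {b : B} (x : H.El b a) : happ (𝟙 H) x = x := by simp [happ]

theorem happ_comp {H K L : Profunctor.{w} A B} (t : H ⟶ K) (t' : K ⟶ L) {a : A} {b : B}
    (x : H.El b a) : happ (t ≫ t') x = happ t' (happ t x) := by simp [happ]

theorem happ_cov {H K : Profunctor.{w} A B} (t : H ⟶ K) {a a' : A} (f : a ⟶ a') {b : B}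
    (x : H.El b a) : happ t (H.cov f x) = K.cov f (happ t x) :=
  ConcreteCategory.congr_hom (NatTrans.congr_app (t.naturality f) (op b)) x

theorem happ_con {H K : Profunctor.{w} A B} (t : H ⟶ K) {a : A} {b b' : B} (g : b ⟶ b')
    (x : H.El b' a) : happ t (H.con g x) = K.con g (happ t x) :=
  ConcreteCategory.congr_hom ((t.app a).naturality g.op) x

/-- The relation generating the coend `∫ᵇ K(c, b) × H(b, a)`. -/
inductive CoendRel (H : Profunctor.{w} A B) (K : Profunctor.{w} B C) (c : C) (a : A) :
    (Σ b : B, K.El c b × H.El b a) → (Σ b : B, K.El c b × H.El b a) → Prop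
  | mk {b b' : B} (g : b ⟶ b') (y : K.El c b) (x : H.El b' a) :
    CoendRel H K c a ⟨b, y, H.con g x⟩ ⟨b', K.cov g y, x⟩

/-- The coend `∫ᵇ K(c, b) × H(b, a)`. -/
def Coend (H : Profunctor.{w} A B) (K : Profunctor.{w} B C) (c : C) (a : A) : Type w :=
  Quot (CoendRel H K c a)

/-- The class of `(y, x)` in the coend. -/
def Coend.mk {H : Profunctor.{w} A B} {K : Profunctor.{w} B C} {c : C} {a : A} {b : B}
    (y : K.El c b) (x : H.El b a) : Coend H K c a :=
  Quot.mk _ ⟨b, y, x⟩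

theorem Coend.sound {H : Profunctor.{w} A B} {K : Profunctor.{w} B C} {c : C} {a : A} {b b' : B}
    (g : b ⟶ b') (y : K.El c b) (x : H.El b' a) :
    (Coend.mk y (H.con g x) : Coend H K c a) = Coend.mk (K.cov g y) x :=
  Quot.sound ⟨g, y, x⟩

theorem Coend.ind {H : Profunctor.{w} A B} {K : Profunctor.{w} B C} {c : C} {a : A}
    {P : Coend H K c a → Prop} (e : ∀ (b : B) (y : K.El c b) (x : H.El b a), P (Coend.mk y x))
    (z : Coend H K c a) : P z :=
  Quot.ind (fun ⟨b, y, x⟩ => e b y x) z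

/-- Functions out of the coend. -/
def Coend.lift {H : Profunctor.{w} A B} {K : Profunctor.{w} B C} {c : C} {a : A} {T : Type*}
    (t : ∀ b : B, K.El c b → H.El b a → T)
    (e : ∀ (b b' : B) (g : b ⟶ b') (y : K.El c b) (x : H.El b' a),
      t b y (H.con g x) = t b' (K.cov g y) x)
    (z : Coend H K c a) : T :=
  Quot.lift (fun p : Σ b : B, K.El c b × H.El b a => t p.1 p.2.1 p.2.2)
    (fun _ _ r => by cases r; exact e _ _ _ _ _) z

/-- The composite profunctor, "first `H`, then `K`". -/
def comp (H : Profunctor.{w} A B) (K : Profunctor.{w} B C) : Profunctor.{w} A C :=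
  .ofCore
    { obj := fun a c => Coend H K c a
      map := fun f g => TypeCat.ofHom (Coend.lift (fun _ y x => Coend.mk (K.con g y) (H.cov f x))
        (fun _ _ k y x => by rw [cov_con, Coend.sound, cov_con]))
      map_id := fun a c => ConcreteCategory.hom_ext _ _ (fun z => by
        induction z using Coend.ind with
        | e b y x =>
          change Coend.mk (K.con (𝟙 c) y) (H.cov (𝟙 a) x) = Coend.mk y x
          rw [con_id, cov_id])
      map_comp := fun f f' g g' => ConcreteCategory.hom_ext _ _ (fun z => by
        induction z using Coend.ind with
        | e b y x =>
          change Coend.mk (K.con (g ≫ g') y) (H.cov (f ≫ f') x) =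
            Coend.mk (K.con g (K.con g' y)) (H.cov f' (H.cov f x))
          rw [con_comp, cov_comp]) }

@[simp] theorem comp_cov (H : Profunctor.{w} A B) (K : Profunctor.{w} B C) {a a' : A} (f : a ⟶ a')
    {c : C} {b : B} (y : K.El c b) (x : H.El b a) :
    (H.comp K).cov f (Coend.mk y x : Coend H K c a) = (Coend.mk y (H.cov f x) : Coend H K c a') :=
  congrArg (fun y' => (Coend.mk y' (H.cov f x) : Coend H K c a')) (K.con_id y)

@[simp] theorem comp_con (H : Profunctor.{w} A B) (K : Profunctor.{w} B C) {c c' : C} (g : c ⟶ c')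
    {a : A} {b : B} (y : K.El c' b) (x : H.El b a) :
    (H.comp K).con g (Coend.mk y x : Coend H K c' a) = (Coend.mk (K.con g y) x : Coend H K c a) :=
  congrArg (fun x' => (Coend.mk (K.con g y) x' : Coend H K c a)) (H.cov_id x)

@[simp] theorem id_cov {a a' b : A} (f : a ⟶ a') (x : b ⟶ a) :
    (Profunctor.id (C := A)).cov f x = x ≫ f := rfl

@[simp] theorem id_con {a b b' : A} (g : b ⟶ b') (x : b' ⟶ a) :
    (Profunctor.id (C := A)).con g x = g ≫ x := rfl

end

/-- A square of profunctors: a natural transformation `H(b, a) → H'(G b, F a)`. -/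
@[ext]
structure Square {A B A' B' : Type w} [Category.{w} A] [Category.{w} B] [Category.{w} A']
    [Category.{w} B'] (H : Profunctor.{w} A B) (H' : Profunctor.{w} A' B') (F : A ⥤ A')
    (G : B ⥤ B') where
  app (a : A) (b : B) (x : H.El b a) : H'.El (G.obj b) (F.obj a)
  app_cov {a a' : A} {b : B} (f : a ⟶ a') (x : H.El b a) :
    app a' b (H.cov f x) = H'.cov (F.map f) (app a b x)
  app_con {a : A} {b b' : B} (g : b ⟶ b') (x : H.El b' a) :
    app a b (H.con g x) = H'.con (G.map g) (app a b' x)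

namespace Square

attribute [simp] app_cov app_con

variable {A B C D A' B' C' D' A'' B'' C'' : Type w}
  [Category.{w} A] [Category.{w} B] [Category.{w} C] [Category.{w} D]
  [Category.{w} A'] [Category.{w} B'] [Category.{w} C'] [Category.{w} D']
  [Category.{w} A''] [Category.{w} B''] [Category.{w} C'']

/-- vertical identity -/
@[simps] def vid (H : Profunctor.{w} A B) : Square H H (𝟭 A) (𝟭 B) where
  app _ _ x := x
  app_cov _ _ := rfl
  app_con _ _ := rfl

/-- vertical composition -/
@[simps] def vcomp {H : Profunctor.{w} A B} {H' : Profunctor.{w} A' B'}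
    {H'' : Profunctor.{w} A'' B''} {F : A ⥤ A'} {G : B ⥤ B'} {F' : A' ⥤ A''} {G' : B' ⥤ B''}
    (α : Square H H' F G) (α' : Square H' H'' F' G') : Square H H'' (F ⋙ F') (G ⋙ G') where
  app a b x := α'.app _ _ (α.app a b x)
  app_cov f x := by simp
  app_con g x := by simp

/-- The horizontal identity square on a functor, given by its action on morphisms. -/
@[simps] def hid (F : A ⥤ A') : Square Profunctor.id Profunctor.id F F where
  app _ _ x := F.map x
  app_cov f x := F.map_comp x f
  app_con g x := F.map_comp g x

/-- horizontal composition -/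
def hcomp {H : Profunctor.{w} A B} {K : Profunctor.{w} B C} {H' : Profunctor.{w} A' B'}
    {K' : Profunctor.{w} B' C'} {F : A ⥤ A'} {G : B ⥤ B'} {L : C ⥤ C'}
    (α : Square H H' F G) (β : Square K K' G L) : Square (H.comp K) (H'.comp K') F L where
  app a c := Coend.lift (fun b y x => (Coend.mk (β.app b c y) (α.app a b x) :
      Coend H' K' (L.obj c) (F.obj a)))
    (fun b b' g y x => by rw [app_con, Coend.sound, app_cov])
  app_cov {a a' c} f z := by
    induction z using Coend.ind with
    | e b y x =>
      rw [comp_cov]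
      refine Eq.trans ?_ (comp_cov H' K' (F.map f) (β.app b c y) (α.app a b x)).symm
      exact congrArg (fun x' => (Coend.mk (β.app b c y) x' : Coend H' K' (L.obj c) (F.obj a')))
        (α.app_cov f x)
  app_con {a c c'} g z := by
    induction z using Coend.ind with
    | e b y x =>
      rw [comp_con]
      refine Eq.trans ?_ (comp_con H' K' (L.map g) (β.app b c' y) (α.app a b x)).symm
      exact congrArg (fun y' => (Coend.mk y' (α.app a b x) : Coend H' K' (L.obj c) (F.obj a)))
        (β.app_con g y)

/-- `H ∘ hom → H` -/
def lu (H : Profunctor.{w} A B) : Square (Profunctor.id.comp H) H (𝟭 A) (𝟭 B) where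
  app a b := Coend.lift (fun _ y (x : _ ⟶ a) => H.cov x y)
    (fun _ _ g y x => H.cov_comp g x y)
  app_cov {a a' b} f z := by
    induction z using Coend.ind with
    | e i y x => exact (congrArg _ (comp_cov _ _ f y x)).trans (H.cov_comp x f y)
  app_con {a b b'} g z := by
    induction z using Coend.ind with
    | e i y x => exact (congrArg _ (comp_con _ _ g y x)).trans (H.cov_con x g y)

/-- inverse of `lu` -/
def luInv (H : Profunctor.{w} A B) : Square H (Profunctor.id.comp H) (𝟭 A) (𝟭 B) where
  app a b x := (Coend.mk x (𝟙 a) : Coend Profunctor.id H b a)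
  app_cov {a a' b} f x := by
    refine Eq.trans ?_ (comp_cov Profunctor.id H f x (𝟙 a)).symm
    refine (Coend.sound (H := Profunctor.id) f x (𝟙 a')).symm.trans (congrArg (Coend.mk x) ?_)
    exact (Category.comp_id f).trans (Category.id_comp f).symm
  app_con {a b b'} g x := (comp_con Profunctor.id H g x (𝟙 a)).symm

/-- `hom ∘ H → H` -/
def ru (H : Profunctor.{w} A B) : Square (H.comp Profunctor.id) H (𝟭 A) (𝟭 B) where
  app a b := Coend.lift (fun _ (y : b ⟶ _) x => H.con y x)
    (fun _ _ g y x => (H.con_comp y g x).symm)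
  app_cov {a a' b} f z := by
    induction z using Coend.ind with
    | e i y x => exact (congrArg _ (comp_cov _ _ f y x)).trans (H.cov_con f y x).symm
  app_con {a b b'} g z := by
    induction z using Coend.ind with
    | e i y x => exact (congrArg _ (comp_con _ _ g y x)).trans (H.con_comp g y x)

/-- inverse of `ru` -/
def ruInv (H : Profunctor.{w} A B) : Square H (H.comp Profunctor.id) (𝟭 A) (𝟭 B) where
  app a b x := (Coend.mk (𝟙 b) x : Coend H Profunctor.id b a)
  app_cov {a a' b} f x := (comp_cov H Profunctor.id f (𝟙 b) x).symm
  app_con {a b b'} g x := by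
    refine Eq.trans ?_ (comp_con H Profunctor.id g (𝟙 b') x).symm
    refine (Coend.sound (K := Profunctor.id) g (𝟙 b) x).trans
      (congrArg (fun y => Coend.mk y x) ?_)
    exact (Category.id_comp g).trans (Category.comp_id g).symm

/-- The map `(l, (k, h)) ↦ ((l, k), h)` between iterated coends. -/
def assocFun (H : Profunctor.{w} A B) (K : Profunctor.{w} B C) (L : Profunctor.{w} C D)
    (a : A) (d : D) : Coend (H.comp K) L d a → Coend H (K.comp L) d a :=
  Coend.lift
    (fun c l z => Coend.lift
      (fun b k h => (Coend.mk (Coend.mk l k : Coend K L d b) h : Coend H (K.comp L) d a))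
      (fun b b' g k h => (Coend.sound (K := K.comp L) g _ h).trans
        (congrArg (fun t => (Coend.mk t h : Coend H (K.comp L) d a)) (comp_cov K L g l k))) z)
    (fun c c' g l z => by
      induction z using Coend.ind with
      | e b k h =>
        refine (congrArg _ (comp_con H K g k h)).trans ?_
        exact congrArg (fun t => (Coend.mk t h : Coend H (K.comp L) d a)) (Coend.sound g l k))

/-- associativity of composition of profunctors -/
def assoc (H : Profunctor.{w} A B) (K : Profunctor.{w} B C) (L : Profunctor.{w} C D) :
    Square ((H.comp K).comp L) (H.comp (K.comp L)) (𝟭 A) (𝟭 D) where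
  app a d := assocFun H K L a d
  app_cov {a a' d} f z := by
    induction z using Coend.ind with
    | e c l z =>
      induction z using Coend.ind with
      | e b k h =>
        refine (congrArg _ (comp_cov (H.comp K) L f l _)).trans ?_
        refine Eq.trans ?_ (comp_cov H (K.comp L) f (Coend.mk l k : Coend K L d b) h).symm
        exact congrArg (fun t => assocFun H K L a' d (Coend.mk l t)) (comp_cov H K f k h)
  app_con {a d d'} g z := by
    induction z using Coend.ind with
    | e c l z =>
      induction z using Coend.ind with
      | e b k h =>
        refine (congrArg _ (comp_con (H.comp K) L g l _)).trans ?_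
        refine Eq.trans ?_ (comp_con H (K.comp L) g (Coend.mk l k : Coend K L d' b) h).symm
        exact congrArg (fun t => (Coend.mk t h : Coend H (K.comp L) d a))
          (comp_con K L g l k).symm

/-- The map `((l, k), h) ↦ (l, (k, h))` between iterated coends. -/
def assocInvFun (H : Profunctor.{w} A B) (K : Profunctor.{w} B C) (L : Profunctor.{w} C D)
    (a : A) (d : D) : Coend H (K.comp L) d a → Coend (H.comp K) L d a :=
  Coend.lift
    (fun b z h => Coend.lift
      (fun c l k => (Coend.mk l (Coend.mk k h : Coend H K c a) : Coend (H.comp K) L d a))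
      (fun c c' g l k => (congrArg (fun t => (Coend.mk l t : Coend (H.comp K) L d a))
        (comp_con H K g k h).symm).trans (Coend.sound (H := H.comp K) g l _)) z)
    (fun b b' g z h => by
      induction z using Coend.ind with
      | e c l k =>
        refine Eq.trans ?_ (congrArg _ (comp_cov K L g l k)).symm
        exact congrArg (fun t => (Coend.mk l t : Coend (H.comp K) L d a)) (Coend.sound g k h))

/-- inverse of `assoc` -/
def assocInv (H : Profunctor.{w} A B) (K : Profunctor.{w} B C) (L : Profunctor.{w} C D) :
    Square (H.comp (K.comp L)) ((H.comp K).comp L) (𝟭 A) (𝟭 D) where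
  app a d := assocInvFun H K L a d
  app_cov {a a' d} f z := by
    induction z using Coend.ind with
    | e b z h =>
      induction z using Coend.ind with
      | e c l k =>
        refine (congrArg _ (comp_cov H (K.comp L) f _ h)).trans ?_
        refine Eq.trans ?_ (comp_cov (H.comp K) L f l (Coend.mk k h : Coend H K c a)).symm
        exact congrArg (fun t => (Coend.mk l t : Coend (H.comp K) L d a'))
          (comp_cov H K f k h).symm
  app_con {a d d'} g z := by
    induction z using Coend.ind with
    | e b z h =>
      induction z using Coend.ind with
      | e c l k =>
        refine (congrArg _ (comp_con H (K.comp L) g _ h)).trans ?_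
        refine Eq.trans ?_ (comp_con (H.comp K) L g l (Coend.mk k h : Coend H K c a)).symm
        exact congrArg (fun t => assocInvFun H K L a d (Coend.mk t h)) (comp_con K L g l k)

end Square

end CategoryTheory.Profunctor

section

open CategoryTheory.Profunctor

theorem CategoryTheory.Profunctor.Square.ext_mk {A B C A' C' : Type w}
    [Category.{w} A] [Category.{w} B] [Category.{w} C] [Category.{w} A'] [Category.{w} C']
    {H : Profunctor.{w} A B} {K : Profunctor.{w} B C} {L : Profunctor.{w} A' C'}
    {F : A ⥤ A'} {G : C ⥤ C'} {α β : Profunctor.Square (H.comp K) L F G}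
    (e : ∀ (a : A) (c : C) (b : B) (y : K.El c b) (x : H.El b a),
      α.app a c (Coend.mk y x : Coend H K c a) = β.app a c (Coend.mk y x : Coend H K c a)) :
    α = β := by
  ext a c z
  induction z using Coend.ind with
  | e b y x => exact e a c b y x

/-- The pseudo double category of large categories (categories whose objects and morphisms form
types in `Type w`), functors, profunctors with values in `Type w`, and natural transformations. -/
def PROF : PseudoDoubleCategory.{w, w + 1, w + 1, w} where
  Obj := Cat.{w, w}
  vert := Cat.category
  Hor A B := Profunctor.{w} A B
  Sq H H' F G := Profunctor.Square H H' F.toFunctor G.toFunctor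
  vid H := Profunctor.Square.vid H
  vcomp α α' := Profunctor.Square.vcomp α α'
  vid_vcomp α := HEq.rfl
  vcomp_vid α := HEq.rfl
  vcomp_assoc α α' α'' := HEq.rfl
  hid A := Profunctor.id
  hcomp H K := H.comp K
  hidSq F := Profunctor.Square.hid F.toFunctor
  hcompSq α β := Profunctor.Square.hcomp α β
  hidSq_id A := rfl
  hidSq_comp F G := rfl
  hcompSq_vid H K := Profunctor.Square.ext_mk fun _ _ _ _ _ => rfl
  interchange α β α' β' := Profunctor.Square.ext_mk fun _ _ _ _ _ => rfl
  lu H := Profunctor.Square.lu H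
  luInv H := Profunctor.Square.luInv H
  ru H := Profunctor.Square.ru H
  ruInv H := Profunctor.Square.ruInv H
  assoc H K L := Profunctor.Square.assoc H K L
  assocInv H K L := Profunctor.Square.assocInv H K L
  lu_luInv H := heq_of_eq (Profunctor.Square.ext_mk fun a c b y x =>
    (Coend.sound (H := Profunctor.id) (K := H) x y (𝟙 a)).symm.trans
      (congrArg (fun t : b ⟶ a => (Coend.mk y t : Coend Profunctor.id H c a))
        (Category.comp_id (x : b ⟶ a))))
  luInv_lu H := heq_of_eq (Profunctor.Square.ext (by
    funext a b x
    exact H.cov_id x))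
  ru_ruInv H := heq_of_eq (Profunctor.Square.ext_mk fun a c b y x =>
    (Coend.sound (H := H) (K := Profunctor.id) y (𝟙 c) x).trans
      (congrArg (fun t : c ⟶ b => (Coend.mk t x : Coend H Profunctor.id c a))
        (Category.id_comp (y : c ⟶ b))))
  ruInv_ru H := heq_of_eq (Profunctor.Square.ext (by
    funext a b x
    exact H.con_id x))
  assoc_assocInv H K L := heq_of_eq (Profunctor.Square.ext_mk fun a d c l z => by
    induction z using Coend.ind with
    | e b k h => rfl)
  assocInv_assoc H K L := heq_of_eq (Profunctor.Square.ext_mk fun a d b z h => by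
    induction z using Coend.ind with
    | e c l k => rfl)
  lu_naturality α := heq_of_eq (Profunctor.Square.ext_mk fun a c b y x => α.app_cov x y)
  ru_naturality α := heq_of_eq (Profunctor.Square.ext_mk fun a c b y x => α.app_con y x)
  assoc_naturality α β γ := heq_of_eq (Profunctor.Square.ext_mk fun a d c l z => by
    induction z using Coend.ind with
    | e b k h => rfl)
  triangle H K := heq_of_eq (Profunctor.Square.ext_mk fun a c b k z => by
    induction z using Coend.ind with
    | e b' y h => exact (Coend.sound (H := H) (K := K) y k h).symm)
  pentagon H K L M := heq_of_eq (Profunctor.Square.ext_mk fun a e d m z => by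
    induction z using Coend.ind with
    | e c l z =>
      induction z using Coend.ind with
      | e b k h => rfl)

end

/-! ## Metamodels and models -/

/-- A metamodel of the monoidal category `M` in the category `C`: a functor
`Φ : Mᵒᵖ × Cᵒᵖ × C → Set`, curried as a functor from `Mᵒᵖ` to endo-profunctors on `C`, with
(extra)natural transformations `1 → Φ_I(A, A)` and `Φ_Y(B, D) × Φ_X(A, B) → Φ_{Y ⊗ X}(A, D)`
satisfying the unit and associativity laws. -/
structure Metamodel (M : Type u) [Category.{v} M] [MonoidalCategory M]
    (C : Type w) [Category.{w} C] where
  Φ : Mᵒᵖ ⥤ Profunctor.{w} C C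
  unit (A : C) : (Φ.obj (op (𝟙_ M))).El A A
  mul {X Y : M} {A B D : C} (y : (Φ.obj (op Y)).El B D) (x : (Φ.obj (op X)).El A B) :
    (Φ.obj (op (Y ⊗ X))).El A D
  unit_naturality {A B : C} (f : A ⟶ B) :
    (Φ.obj (op (𝟙_ M))).cov f (unit A) = (Φ.obj (op (𝟙_ M))).con f (unit B)
  mul_map {X X' Y Y' : M} (f : X ⟶ X') (g : Y ⟶ Y') {A B D : C}
    (y : (Φ.obj (op Y')).El B D) (x : (Φ.obj (op X')).El A B) :
    mul (Profunctor.happ (Φ.map g.op) y) (Profunctor.happ (Φ.map f.op) x) =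
      Profunctor.happ (Φ.map (g ⊗ₘ f).op) (mul y x)
  mul_cov {X Y : M} {A B D D' : C} (f : D ⟶ D') (y : (Φ.obj (op Y)).El B D)
    (x : (Φ.obj (op X)).El A B) :
    mul ((Φ.obj (op Y)).cov f y) x = (Φ.obj (op (Y ⊗ X))).cov f (mul y x)
  mul_con {X Y : M} {A A' B D : C} (f : A ⟶ A') (y : (Φ.obj (op Y)).El B D)
    (x : (Φ.obj (op X)).El A' B) :
    mul y ((Φ.obj (op X)).con f x) = (Φ.obj (op (Y ⊗ X))).con f (mul y x)
  mul_middle {X Y : M} {A B B' D : C} (f : B ⟶ B') (y : (Φ.obj (op Y)).El B' D)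
    (x : (Φ.obj (op X)).El A B) :
    mul ((Φ.obj (op Y)).con f y) x = mul y ((Φ.obj (op X)).cov f x)
  unit_mul {X : M} {A B : C} (x : (Φ.obj (op X)).El A B) :
    mul (unit B) x = Profunctor.happ (Φ.map (λ_ X).hom.op) x
  mul_unit {X : M} {A B : C} (x : (Φ.obj (op X)).El A B) :
    mul x (unit A) = Profunctor.happ (Φ.map (ρ_ X).hom.op) x
  mul_assoc {X Y Z : M} {A B D E : C} (z : (Φ.obj (op Z)).El D E) (y : (Φ.obj (op Y)).El B D)
    (x : (Φ.obj (op X)).El A B) :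
    Profunctor.happ (Φ.map (α_ Z Y X).inv.op) (mul (mul z y) x) = mul z (mul y x)

namespace Metamodel

variable {M : Type u} [Category.{v} M] [MonoidalCategory M] {C : Type w} [Category.{w} C]

/-- The square of profunctors `Φ_X → Φ_Y` given by a morphism `X ⟶ Y` of `Mᵒᵖ`. -/
def mapSq (P : Metamodel M C) {X Y : Mᵒᵖ} (f : X ⟶ Y) :
    Profunctor.Square (P.Φ.obj X) (P.Φ.obj Y) (𝟭 C) (𝟭 C) where
  app _ _ x := Profunctor.happ (P.Φ.map f) x
  app_cov k x := Profunctor.happ_cov _ k x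
  app_con k x := Profunctor.happ_con _ k x

/-- The square `C(A, B) → Φ_I(A, B)`. -/
def unitSq (P : Metamodel M C) :
    Profunctor.Square Profunctor.id (P.Φ.obj (op (𝟙_ M))) (𝟭 C) (𝟭 C) where
  app a b (x : b ⟶ a) := (P.Φ.obj (op (𝟙_ M))).cov x (P.unit b)
  app_cov _ _ := Profunctor.cov_comp _ _ _ _
  app_con {_ b b'} g (x : b' ⟶ _) :=
    (Profunctor.cov_comp _ g x (P.unit b)).trans
      ((congrArg _ (P.unit_naturality g)).trans (Profunctor.cov_con _ x g (P.unit b')))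

/-- The square `∫ᴮ Φ_Y(B, D) × Φ_X(A, B) → Φ_{Y ⊗ X}(A, D)`. -/
def mulSq (P : Metamodel M C) (X Y : Mᵒᵖ) :
    Profunctor.Square ((P.Φ.obj Y).comp (P.Φ.obj X)) (P.Φ.obj (Y ⊗ X)) (𝟭 C) (𝟭 C) where
  app a c := Profunctor.Coend.lift (fun _ x y => P.mul y x)
    (fun _ _ g x y => P.mul_middle g y x)
  app_cov {a a' c} f z := by
    induction z using Profunctor.Coend.ind with
    | e b x y => exact (congrArg _ (Profunctor.comp_cov _ _ f x y)).trans (P.mul_cov f y x)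
  app_con {a c c'} g z := by
    induction z using Profunctor.Coend.ind with
    | e b x y => exact (congrArg _ (Profunctor.comp_con _ _ g x y)).trans (P.mul_con g y x)

theorem mapSq_id (P : Metamodel M C) (X : Mᵒᵖ) : P.mapSq (𝟙 X) = Profunctor.Square.vid _ := by
  ext a b x
  change Profunctor.happ (P.Φ.map (𝟙 X)) x = x
  rw [P.Φ.map_id, Profunctor.happ_id]

theorem mapSq_comp (P : Metamodel M C) {X Y Z : Mᵒᵖ} (f : X ⟶ Y) (g : Y ⟶ Z) :
    P.mapSq (f ≫ g) = (P.mapSq f).vcomp (P.mapSq g) := by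
  ext a b x
  change Profunctor.happ (P.Φ.map (f ≫ g)) x = _
  rw [P.Φ.map_comp, Profunctor.happ_comp]
  rfl

theorem happ_map_hom_inv (P : Metamodel M C) {X Y : M} (e : X ≅ Y) {a b : C}
    (x : (P.Φ.obj (op Y)).El b a) :
    Profunctor.happ (P.Φ.map e.inv.op) (Profunctor.happ (P.Φ.map e.hom.op) x) = x := by
  rw [← Profunctor.happ_comp, ← P.Φ.map_comp, ← op_comp, e.inv_hom_id, op_id, P.Φ.map_id,
    Profunctor.happ_id]

theorem mulSq_unit_left (P : Metamodel M C) (X : Mᵒᵖ) :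
    ((Profunctor.Square.hcomp (Profunctor.Square.vid (P.Φ.obj X)) P.unitSq).vcomp
      (P.mulSq (op (𝟙_ M)) X)).vcomp (P.mapSq (ρ_ X).hom) =
    Profunctor.Square.ru (P.Φ.obj X) := by
  refine Profunctor.Square.ext_mk fun a c b (y : c ⟶ b) x => ?_
  change Profunctor.happ (P.Φ.map (ρ_ X.unop).inv.op)
    (P.mul x ((P.Φ.obj (op (𝟙_ M))).cov y (P.unit c))) = (P.Φ.obj X).con y x
  rw [P.unit_naturality, P.mul_con, P.mul_unit, ← Profunctor.happ_con, happ_map_hom_inv]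

theorem mulSq_unit_right (P : Metamodel M C) (X : Mᵒᵖ) :
    ((Profunctor.Square.hcomp P.unitSq (Profunctor.Square.vid (P.Φ.obj X))).vcomp
      (P.mulSq X (op (𝟙_ M)))).vcomp (P.mapSq (λ_ X).hom) =
    Profunctor.Square.lu (P.Φ.obj X) := by
  refine Profunctor.Square.ext_mk fun a c b y (x : b ⟶ a) => ?_
  change Profunctor.happ (P.Φ.map (λ_ X.unop).inv.op)
    (P.mul ((P.Φ.obj (op (𝟙_ M))).cov x (P.unit b)) y) = (P.Φ.obj X).cov x y
  rw [P.mul_cov, P.unit_mul, ← Profunctor.happ_cov, happ_map_hom_inv]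

theorem mulSq_assoc (P : Metamodel M C) (X Y Z : Mᵒᵖ) :
    ((Profunctor.Square.hcomp (Profunctor.Square.vid (P.Φ.obj Z)) (P.mulSq X Y)).vcomp
      (P.mulSq (Y ⊗ X) Z)).vcomp (P.mapSq (α_ Z Y X).inv) =
    ((Profunctor.Square.assocInv (P.Φ.obj Z) (P.Φ.obj Y) (P.Φ.obj X)).vcomp
      (Profunctor.Square.hcomp (P.mulSq Y Z) (Profunctor.Square.vid (P.Φ.obj X)))).vcomp
      (P.mulSq X (Z ⊗ Y)) := by
  refine Profunctor.Square.ext_mk fun a d b t z => ?_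
  induction t using Profunctor.Coend.ind with
  | e c x y =>
    change Profunctor.happ (P.Φ.map (α_ Z.unop Y.unop X.unop).hom.op) (P.mul z (P.mul y x)) =
      P.mul (P.mul z y) x
    rw [← P.mul_assoc]
    exact P.happ_map_hom_inv (α_ Z.unop Y.unop X.unop).symm _

/-- The lax double functor corresponding to a metamodel. -/
def toLaxDoubleFunctor (P : Metamodel M C) : LaxDoubleFunctor (HSigma Mᵒᵖ) PROF.{w}.hop where
  vert := (Functor.const _).obj (Cat.of C)
  hor X := P.Φ.obj X
  sq f := P.mapSq f
  sq_vid X := heq_of_eq (P.mapSq_id X)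
  sq_vcomp f g := heq_of_eq (P.mapSq_comp f g)
  unit _ := P.unitSq
  comp X Y := P.mulSq X Y
  unit_naturality _ := heq_of_eq (congrArg P.unitSq.vcomp (P.mapSq_id (𝟙_ Mᵒᵖ)).symm)
  comp_naturality {_ _ _ _ _ _ X Y X' Y' _ _ _} f g := heq_of_eq
    (Profunctor.Square.ext_mk (H := P.Φ.obj Y) (K := P.Φ.obj X) (L := P.Φ.obj (Y' ⊗ X'))
      (F := 𝟭 C) (G := 𝟭 C) (fun a c b x y => P.mul_map f.unop g.unop y x))
  left_unitality X := heq_of_eq (P.mulSq_unit_left X)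
  right_unitality X := heq_of_eq (P.mulSq_unit_right X)
  associativity X Y Z := heq_of_eq (P.mulSq_assoc X Y Z)

/-- A model of the theory (monoid object) `T` in `C` with respect to a metamodel. -/
structure Model (P : Metamodel M C) (T : Mon M) where
  carrier : C
  str : (P.Φ.obj (op T.X)).El carrier carrier
  unit_str : Profunctor.happ (P.Φ.map (MonObj.one (X := T.X)).op) str =
    P.unit carrier
  mul_str : Profunctor.happ (P.Φ.map (MonObj.mul (X := T.X)).op) str =
    P.mul str str

/-- A homomorphism of models. -/
@[ext]
structure Model.Hom {P : Metamodel M C} {T : Mon M} (x y : P.Model T) where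
  hom : x.carrier ⟶ y.carrier
  comm : (P.Φ.obj (op T.X)).cov hom x.str = (P.Φ.obj (op T.X)).con hom y.str

instance (P : Metamodel M C) (T : Mon M) : Category.{w} (P.Model T) where
  Hom x y := Model.Hom x y
  id x := ⟨𝟙 _, by rw [Profunctor.cov_id, Profunctor.con_id]⟩
  comp f g := ⟨f.hom ≫ g.hom, by
    rw [Profunctor.cov_comp, f.comm, Profunctor.cov_con, g.comm, Profunctor.con_comp]⟩
  id_comp f := Model.Hom.ext (Category.id_comp f.hom)
  comp_id f := Model.Hom.ext (Category.comp_id f.hom)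
  assoc f g k := Model.Hom.ext (Category.assoc f.hom g.hom k.hom)

/-- The forgetful functor from models to `C`. -/
def forget (P : Metamodel M C) (T : Mon M) : P.Model T ⥤ C where
  obj x := x.carrier
  map f := Model.Hom.hom f

/-- The square sending a homomorphism `f : (A, ξ) ⟶ (B, ζ)` to `Φ_T(A, f)(ξ) ∈ Φ_T(A, B)`. -/
def modelSq (P : Metamodel M C) (T : Mon M) :
    Profunctor.Square Profunctor.id (P.Φ.obj (op T.X)) (P.forget T) (P.forget T) where
  app y x f := (P.Φ.obj (op T.X)).cov ((P.forget T).map (show x ⟶ y from f)) x.str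
  app_cov f g := (congrArg (fun t => (P.Φ.obj (op T.X)).cov t _)
    ((P.forget T).map_comp _ _)).trans (Profunctor.cov_comp _ _ _ _)
  app_con {y x x'} g f := by
    refine (congrArg (fun t => (P.Φ.obj (op T.X)).cov t _)
      ((P.forget T).map_comp g f)).trans ?_
    refine (Profunctor.cov_comp _ _ _ _).trans ?_
    refine (congrArg _ (Model.Hom.comm g)).trans ?_
    exact Profunctor.cov_con _ _ _ _

end Metamodel

/-! ## The universal theory and the diagram of a theory and a metamodel -/

open scoped Simplicial

theorem AugmentedSimplexCategory.hom_point_ext {x : AugmentedSimplexCategory}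
    (f g : x ⟶ (WithInitial.of ⦋0⦌ : AugmentedSimplexCategory)) : f = g :=
  match x, f, g with
  | .of x, f, g =>
    Limits.IsTerminal.hom_ext SimplexCategory.isTerminalZero (show x ⟶ ⦋0⦌ from f)
      (show x ⟶ ⦋0⦌ from g)
  | .star, _, _ => rfl

/-- The one-element ordinal, with its unique monoid structure in the augmented simplex category
(the category of finite ordinals and monotone maps, with ordinal sum as tensor product). -/
def universalTheory : Mon AugmentedSimplexCategory where
  X := WithInitial.of ⦋0⦌
  mon :=
    { one := WithInitial.starInitial.to _
      mul := (SimplexCategory.isTerminalZero.from ⦋0 + 0 + 1⦌ : ⦋0 + 0 + 1⦌ ⟶ ⦋0⦌)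
      one_mul := AugmentedSimplexCategory.hom_point_ext _ _
      mul_one := AugmentedSimplexCategory.hom_point_ext _ _
      mul_assoc := AugmentedSimplexCategory.hom_point_ext _ _ }

/-- The composite lax double functor `HΣ(Δₐᵒᵖ) → HΣ(Mᵒᵖ) → PROFᵒᵖ` of a strong monoidal functor
`F : Δₐ ⥤ M` and a metamodel of `M`. -/
def modelDiagram {M : Type u} [Category.{v} M] [MonoidalCategory M] {C : Type w} [Category.{w} C]
    (F : AugmentedSimplexCategory ⥤ M) [F.Monoidal] (P : Metamodel M C) :
    LaxDoubleFunctor (HSigma AugmentedSimplexCategoryᵒᵖ) PROF.{w}.hop :=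
  (HSigma.map F.op).trans P.toLaxDoubleFunctor

/-! ## The one-element ordinal is terminal -/

/-- The unique morphism to the one-element ordinal. -/
def AugmentedSimplexCategory.toPoint (X : AugmentedSimplexCategory) :
    X ⟶ universalTheory.X :=
  match X with
  | .of x => (SimplexCategory.isTerminalZero.from x : x ⟶ ⦋0⦌)
  | .star => WithInitial.starInitial.to _

open AugmentedSimplexCategory

section

variable {M : Type u} [Category.{v} M] [MonoidalCategory M] {T : Mon M}
  (F : AugmentedSimplexCategory ⥤ M) [F.Monoidal] (e : F.mapMon.obj universalTheory ≅ T)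

/-- The morphism of `M` underlying the isomorphism `F(U) ≅ T`. -/
def pointHom : F.obj universalTheory.X ⟶ T.X := e.hom.hom

theorem pointHom_one :
    Functor.LaxMonoidal.ε F ≫ F.map (MonObj.one (X := universalTheory.X)) ≫ pointHom F e =
      MonObj.one (X := T.X) :=
  (Category.assoc _ _ _).symm.trans (IsMonHom.one_hom e.hom.hom)

theorem pointHom_mul :
    Functor.LaxMonoidal.μ F universalTheory.X universalTheory.X ≫
      F.map (MonObj.mul (X := universalTheory.X)) ≫ pointHom F e =
      (pointHom F e ⊗ₘ pointHom F e) ≫ MonObj.mul (X := T.X) :=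
  (Category.assoc _ _ _).symm.trans (IsMonHom.mul_hom e.hom.hom)

/-- The multiplication `F(X) ⟶ T` of the theory of arity `X`. -/
def iteratedMul (X : AugmentedSimplexCategory) : F.obj X ⟶ T.X :=
  F.map (toPoint X) ≫ pointHom F e

theorem map_iteratedMul {X Y : AugmentedSimplexCategory} (f : X ⟶ Y) :
    F.map f ≫ iteratedMul F e Y = iteratedMul F e X := by
  rw [iteratedMul, iteratedMul, ← Category.assoc, ← F.map_comp]
  exact congrArg (fun t => F.map t ≫ pointHom F e) (hom_point_ext _ _)

theorem iteratedMul_point : iteratedMul F e universalTheory.X = pointHom F e := by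
  rw [iteratedMul, show toPoint universalTheory.X = 𝟙 _ from hom_point_ext _ _, F.map_id,
    Category.id_comp]

theorem iteratedMul_unit :
    iteratedMul F e (𝟙_ _) = Functor.OplaxMonoidal.η F ≫ MonObj.one (X := T.X) := by
  rw [← pointHom_one F e, iteratedMul,
    show toPoint (𝟙_ _) = MonObj.one (X := universalTheory.X) from hom_point_ext _ _]
  simp

theorem iteratedMul_tensor (X Y : AugmentedSimplexCategory) :
    iteratedMul F e (X ⊗ Y) = Functor.OplaxMonoidal.δ F X Y ≫
      (iteratedMul F e X ⊗ₘ iteratedMul F e Y) ≫ MonObj.mul (X := T.X) := by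
  rw [iteratedMul, iteratedMul, iteratedMul, ← MonoidalCategory.tensorHom_comp_tensorHom, Category.assoc,
    ← pointHom_mul F e, show toPoint (X ⊗ Y) = (toPoint X ⊗ₘ toPoint Y) ≫
      MonObj.mul (X := universalTheory.X) from hom_point_ext _ _, F.map_comp]
  simp

end

/-! ## The cone of models -/

namespace Metamodel

variable {M : Type u} [Category.{v} M] [MonoidalCategory M] {C : Type w} [Category.{w} C]
  (P : Metamodel M C)

theorem happ_map_comp {X Y Z : M} (f : X ⟶ Y) (g : Y ⟶ Z) {a b : C}
    (x : (P.Φ.obj (op Z)).El b a) :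
    Profunctor.happ (P.Φ.map (f ≫ g).op) x =
      Profunctor.happ (P.Φ.map f.op) (Profunctor.happ (P.Φ.map g.op) x) := by
  rw [op_comp, P.Φ.map_comp, Profunctor.happ_comp]

variable {T : Mon M} (F : AugmentedSimplexCategory ⥤ M) [F.Monoidal]
  (e : F.mapMon.obj universalTheory ≅ T)

/-- The square sending `f : (A, ξ) ⟶ (B, ζ)` to the restriction of `Φ_T(A, f)(ξ)` along the
multiplication of arity `X`. -/
def modelCell (X : AugmentedSimplexCategoryᵒᵖ) :
    Profunctor.Square Profunctor.id (P.Φ.obj (op (F.obj X.unop))) (P.forget T) (P.forget T) :=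
  Profunctor.Square.vcomp (P.modelSq T) (P.mapSq (iteratedMul F e X.unop).op)

theorem modelCell_app (X : AugmentedSimplexCategoryᵒᵖ) {x y : P.Model T} (f : x ⟶ y) :
    (P.modelCell F e X).app y x f = (P.Φ.obj (op (F.obj X.unop))).cov (Model.Hom.hom f)
      (Profunctor.happ (P.Φ.map (iteratedMul F e X.unop).op) x.str) :=
  Profunctor.happ_cov _ _ _

theorem happ_iteratedMul_unit (x : P.Model T) :
    Profunctor.happ (P.Φ.map (iteratedMul F e (𝟙_ _)).op) x.str =
      Profunctor.happ (P.Φ.map (Functor.OplaxMonoidal.η F).op) (P.unit x.carrier) := by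
  rw [iteratedMul_unit, happ_map_comp, x.unit_str]

theorem happ_iteratedMul_tensor (X Y : AugmentedSimplexCategory) (x : P.Model T) :
    Profunctor.happ (P.Φ.map (iteratedMul F e (X ⊗ Y)).op) x.str =
      Profunctor.happ (P.Φ.map (Functor.OplaxMonoidal.δ F X Y).op)
        (P.mul (Profunctor.happ (P.Φ.map (iteratedMul F e X).op) x.str)
          (Profunctor.happ (P.Φ.map (iteratedMul F e Y).op) x.str)) := by
  rw [iteratedMul_tensor, happ_map_comp, happ_map_comp, x.mul_str, P.mul_map]

theorem happ_mul_modelCell (X Y : AugmentedSimplexCategoryᵒᵖ) {x y : P.Model T} (f : x ⟶ y) :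
    Profunctor.happ (P.Φ.map (Functor.OplaxMonoidal.δ F Y.unop X.unop).op)
      (P.mul ((P.modelCell F e Y).app y x f) ((P.modelCell F e X).app x x (𝟙 x))) =
    (P.modelCell F e (op (Y.unop ⊗ X.unop))).app y x f := by
  have h := P.modelCell_app F e X (𝟙 x)
  rw [show Model.Hom.hom (𝟙 x) = 𝟙 x.carrier from rfl, Profunctor.cov_id] at h
  refine (congrArg (Profunctor.happ _) (congrArg₂ P.mul (P.modelCell_app F e Y f) h)).trans ?_
  refine Eq.trans ?_ (P.modelCell_app F e (op (Y.unop ⊗ X.unop)) f).symm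
  refine (congrArg (Profunctor.happ _) (P.mul_cov (Model.Hom.hom f) _ _)).trans ?_
  refine (Profunctor.happ_cov _ _ _).trans ?_
  exact congrArg _ (P.happ_iteratedMul_tensor F e Y.unop X.unop x).symm

/-- The double cone of models over the diagram of a theory and a metamodel. -/
def modelCone : DoubleCone (modelDiagram F P) (Cat.of (P.Model T)) where
  leg _ := (P.forget T).toCatHom
  cell X := P.modelCell F e X
  leg_naturality _ := rfl
  cell_naturality {i j i' j' X X' f g} α := heq_of_eq (by
    refine Profunctor.Square.ext ?_
    funext y x f
    change Profunctor.happ (P.Φ.map (F.map α.unop).op) (Profunctor.happ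
      (P.Φ.map (iteratedMul F e (unop X)).op) _) = Profunctor.happ
      (P.Φ.map (iteratedMul F e (unop X')).op) _
    rw [← happ_map_comp, map_iteratedMul])
  cell_unit i := heq_of_eq (by
    refine Profunctor.Square.ext ?_
    funext y x f
    refine Eq.trans ?_ (P.modelCell_app F e (op (𝟙_ _)) (x := x) (y := y) f).symm
    refine Eq.trans ?_ (congrArg ((P.Φ.obj (op (F.obj (𝟙_ _)))).cov (Model.Hom.hom f))
      (P.happ_iteratedMul_unit F e x)).symm
    exact Profunctor.happ_cov _ _ _)
  cell_comp {i j k} X Y := heq_of_eq (by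
    refine Profunctor.Square.ext ?_
    funext y x f
    exact P.happ_mul_modelCell F e X Y (x := x) (y := y) f)

theorem modelCone_cell_point : (P.modelCone F e).cell (i := ⟨⟨⟩⟩) (j := ⟨⟨⟩⟩)
    (op universalTheory.X) = Profunctor.Square.vcomp (P.modelSq T) (P.mapSq e.hom.hom.op) :=
  congrArg (fun t : F.obj universalTheory.X ⟶ T.X =>
      Profunctor.Square.vcomp (P.modelSq T) (P.mapSq t.op))
    (iteratedMul_point F e)

end Metamodel

/-! ## The universal property of the cone of models -/

section

variable {M : Type u} [Category.{v} M] [MonoidalCategory M] {T : Mon M}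
  (F : AugmentedSimplexCategory ⥤ M) [F.Monoidal] (e : F.mapMon.obj universalTheory ≅ T)

/-- The morphism of `M` underlying the isomorphism `T ≅ F(U)`. -/
def pointInv : T.X ⟶ F.obj universalTheory.X := e.inv.hom

theorem pointHom_pointInv : pointHom F e ≫ pointInv F e = 𝟙 _ :=
  congrArg Mon.Hom.hom e.hom_inv_id

theorem pointInv_pointHom : pointInv F e ≫ pointHom F e = 𝟙 _ :=
  congrArg Mon.Hom.hom e.inv_hom_id

theorem one_pointInv : MonObj.one (X := T.X) ≫ pointInv F e =
    Functor.LaxMonoidal.ε F ≫ F.map (MonObj.one (X := universalTheory.X)) := by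
  rw [← pointHom_one F e]
  simp [pointHom_pointInv]

theorem mul_pointInv : MonObj.mul (X := T.X) ≫ pointInv F e =
    (pointInv F e ⊗ₘ pointInv F e) ≫
      Functor.LaxMonoidal.μ F universalTheory.X universalTheory.X ≫
        F.map (MonObj.mul (X := universalTheory.X)) := by
  have h := (pointInv F e ⊗ₘ pointInv F e) ≫= pointHom_mul F e =≫ pointInv F e
  rw [Category.assoc (_ ⊗ₘ _), MonoidalCategory.tensorHom_comp_tensorHom_assoc, pointInv_pointHom, id_tensorHom_id,
    Category.id_comp] at h
  rw [← h]
  simp [pointHom_pointInv]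

theorem iteratedMul_pointInv (X : AugmentedSimplexCategory) :
    iteratedMul F e X ≫ pointInv F e = F.map (toPoint X) := by
  rw [iteratedMul, Category.assoc, pointHom_pointInv, Category.comp_id]

end

namespace Metamodel

variable {M : Type u} [Category.{v} M] [MonoidalCategory M] {C : Type w} [Category.{w} C]
  (P : Metamodel M C)

@[simp] theorem happ_map_id {X : M} {a b : C} (x : (P.Φ.obj (op X)).El b a) :
    Profunctor.happ (P.Φ.map (𝟙 X).op) x = x := by
  rw [op_id, P.Φ.map_id, Profunctor.happ_id]

theorem Model.ext_str {T : Mon M} {x y : P.Model T} (h : x.carrier = y.carrier)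
    (hs : HEq x.str y.str) : x = y := by
  cases x
  cases y
  cases h
  cases hs
  rfl

instance (T : Mon M) : (P.forget T).Faithful where
  map_injective h := Model.Hom.ext h

theorem functor_model_ext {T : Mon M} {A : Type w} [Category.{w} A] {k l : A ⥤ P.Model T}
    (h : k ⋙ P.forget T = l ⋙ P.forget T) (hs : ∀ a, HEq (k.obj a).str (l.obj a).str) :
    k = l := by
  refine CategoryTheory.Functor.ext (fun a => Model.ext_str P (Functor.congr_obj h a) (hs a))
    fun a b f => (P.forget T).map_injective ?_
  rw [Functor.map_comp, Functor.map_comp, eqToHom_map, eqToHom_map]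
  exact Functor.congr_hom h f

variable {T : Mon M} (F : AugmentedSimplexCategory ⥤ M) [F.Monoidal]
  (e : F.mapMon.obj universalTheory ≅ T)

theorem happ_pointInv_pointHom {a b : C} (x : (P.Φ.obj (op T.X)).El b a) :
    Profunctor.happ (P.Φ.map (pointInv F e).op)
      (Profunctor.happ (P.Φ.map (pointHom F e).op) x) = x := by
  rw [← happ_map_comp, pointInv_pointHom, happ_map_id]

section lift

variable {P F} {A : Cat.{w, w}} (c : DoubleCone (modelDiagram F P) A)

/-- The functor underlying a double cone. -/
def coneFunctor : A ⥤ C := (c.leg ⟨⟨⟩⟩).toFunctor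

/-- The squares underlying a double cone. -/
def coneCell (X : AugmentedSimplexCategory) : Profunctor.Square Profunctor.id
    (P.Φ.obj (op (F.obj X))) (coneFunctor c) (coneFunctor c) :=
  c.cell (i := ⟨⟨⟩⟩) (j := ⟨⟨⟩⟩) (op X)

/-- The element of `Φ_{F(X)}(k a, k a)` given by a double cone. -/
def coneEl (X : AugmentedSimplexCategory) (a : A) :
    (P.Φ.obj (op (F.obj X))).El ((coneFunctor c).obj a) ((coneFunctor c).obj a) :=
  (coneCell c X).app a a (𝟙 a)

theorem cov_coneEl (X : AugmentedSimplexCategory) {a b : A} (f : a ⟶ b) :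
    (P.Φ.obj (op (F.obj X))).cov ((coneFunctor c).map f) (coneEl c X a) =
      (coneCell c X).app b a f :=
  ((coneCell c X).app_cov f (𝟙 a)).symm.trans
    (congrArg ((coneCell c X).app b a) (Category.id_comp f))

theorem con_coneEl (X : AugmentedSimplexCategory) {a b : A} (f : a ⟶ b) :
    (P.Φ.obj (op (F.obj X))).con ((coneFunctor c).map f) (coneEl c X b) =
      (coneCell c X).app b a f :=
  ((coneCell c X).app_con f (𝟙 b)).symm.trans
    (congrArg ((coneCell c X).app b a) (Category.comp_id f))

theorem map_coneEl {X Y : AugmentedSimplexCategory} (f : X ⟶ Y) (a : A) :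
    Profunctor.happ (P.Φ.map (F.map f).op) (coneEl c Y a) = coneEl c X a :=
  congrArg (fun s : Profunctor.Square Profunctor.id (P.Φ.obj (op (F.obj X))) (coneFunctor c)
      (coneFunctor c) => s.app a a (𝟙 a))
    (eq_of_heq (c.cell_naturality (i := ⟨⟨⟩⟩) (j := ⟨⟨⟩⟩) (i' := ⟨⟨⟩⟩) (j' := ⟨⟨⟩⟩) (X := op Y)
      (X' := op X) (f := 𝟙 _) (g := 𝟙 _) f.op))

theorem coneEl_unit (a : A) : coneEl c (𝟙_ _) a =
    Profunctor.happ (P.Φ.map (Functor.OplaxMonoidal.η F).op)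
      (P.unit ((coneFunctor c).obj a)) := by
  refine (congrArg (fun s : Profunctor.Square Profunctor.id (P.Φ.obj (op (F.obj (𝟙_ _))))
      (coneFunctor c) (coneFunctor c) => s.app a a (𝟙 a))
    (eq_of_heq (c.cell_unit ⟨⟨⟩⟩))).symm.trans ?_
  refine congrArg (Profunctor.happ (P.Φ.map (Functor.OplaxMonoidal.η F).op)) ?_
  change (P.Φ.obj (op (𝟙_ M))).cov ((coneFunctor c).map (𝟙 a)) (P.unit _) = _
  rw [CategoryTheory.Functor.map_id, Profunctor.cov_id]

theorem coneEl_tensor (X Y : AugmentedSimplexCategory) (a : A) : coneEl c (X ⊗ Y) a =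
    Profunctor.happ (P.Φ.map (Functor.OplaxMonoidal.δ F X Y).op)
      (P.mul (coneEl c X a) (coneEl c Y a)) :=
  (congrArg (fun s : Profunctor.Square Profunctor.id (P.Φ.obj (op (F.obj (X ⊗ Y))))
      (coneFunctor c) (coneFunctor c) => s.app a a (𝟙 a))
    (eq_of_heq (c.cell_comp (i := ⟨⟨⟩⟩) (j := ⟨⟨⟩⟩) (k := ⟨⟨⟩⟩) (op Y) (op X)))).symm

/-- The model structure on `k a` given by a double cone. -/
def coneModel (a : A) : P.Model T where
  carrier := (coneFunctor c).obj a
  str := Profunctor.happ (P.Φ.map (pointInv F e).op) (coneEl c universalTheory.X a)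
  unit_str := by
    rw [← happ_map_comp, one_pointInv, happ_map_comp, map_coneEl]
    refine (congrArg _ (coneEl_unit c a)).trans ?_
    rw [← happ_map_comp, Functor.Monoidal.ε_η, happ_map_id]
  mul_str := by
    rw [← happ_map_comp, mul_pointInv, happ_map_comp, happ_map_comp, map_coneEl, P.mul_map]
    refine congrArg _ ((congrArg _ (coneEl_tensor c _ _ a)).trans ?_)
    rw [← happ_map_comp, Functor.Monoidal.μ_δ, happ_map_id]

/-- The functor to models induced by a double cone. -/
def coneLift : A ⥤ P.Model T where
  obj a := coneModel e c a
  map f := ⟨(coneFunctor c).map f, by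
    refine (Profunctor.happ_cov _ _ _).symm.trans (Eq.trans ?_ (Profunctor.happ_con _ _ _))
    exact congrArg _ ((cov_coneEl c _ f).trans (con_coneEl c _ f).symm)⟩
  map_id a := Model.Hom.ext ((coneFunctor c).map_id a)
  map_comp f g := Model.Hom.ext ((coneFunctor c).map_comp f g)

theorem happ_iteratedMul_coneModel (X : AugmentedSimplexCategory) (a : A) :
    Profunctor.happ (P.Φ.map (iteratedMul F e X).op) (coneModel e c a).str = coneEl c X a := by
  refine (P.happ_map_comp _ _ _).symm.trans ?_
  rw [iteratedMul_pointInv]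
  exact map_coneEl c _ a

theorem factors_coneLift : (P.modelCone F e).Factors c (coneLift e c).toCatHom where
  leg _ := rfl
  cell X := heq_of_eq (by
    refine Profunctor.Square.ext ?_
    funext b a f
    refine (P.modelCell_app F e X ((coneLift e c).map f)).trans ?_
    refine Eq.trans ?_ (cov_coneEl c (unop X) f)
    exact congrArg ((P.Φ.obj (op (F.obj (unop X)))).cov ((coneFunctor c).map f))
      (happ_iteratedMul_coneModel e c (unop X) a))

end lift

theorem square_app_heq {A B A' B' : Type w} [Category.{w} A] [Category.{w} B] [Category.{w} A']
    [Category.{w} B'] {H : Profunctor.{w} A B} {K : Profunctor.{w} A' B'} {G G' : A ⥤ A'}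
    {L L' : B ⥤ B'} (hG : G = G') (hL : L = L') {α : Profunctor.Square H K G L}
    {β : Profunctor.Square H K G' L'} (h : HEq α β) (a : A) (b : B) (x : H.El b a) :
    HEq (α.app a b x) (β.app a b x) := by
  subst hG hL
  rw [eq_of_heq h]

theorem modelCell_point_app_id (x : P.Model T) :
    (P.modelCell F e (op universalTheory.X)).app x x (𝟙 x) =
      Profunctor.happ (P.Φ.map (pointHom F e).op) x.str := by
  refine (P.modelCell_app F e (op universalTheory.X) (𝟙 x)).trans ?_
  refine (Profunctor.cov_id _ _).trans ?_
  exact congrArg (fun t => Profunctor.happ (P.Φ.map (Quiver.Hom.op t)) x.str)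
    (iteratedMul_point F e)

theorem str_heq_of_happ_pointHom {x y : P.Model T} (h : x.carrier = y.carrier)
    (hs : HEq (Profunctor.happ (P.Φ.map (pointHom F e).op) x.str)
      (Profunctor.happ (P.Φ.map (pointHom F e).op) y.str)) : HEq x.str y.str := by
  obtain ⟨a, s, _, _⟩ := x
  obtain ⟨b, t, _, _⟩ := y
  obtain rfl : a = b := h
  have := congrArg (Profunctor.happ (P.Φ.map (pointInv F e).op)) (eq_of_heq hs)
  rw [happ_pointInv_pointHom, happ_pointInv_pointHom] at this
  exact heq_of_eq this

theorem existsUnique_model_square {A A' : Type w} [Category.{w} A] [Category.{w} A']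
    (k : A ⥤ P.Model T) (k' : A' ⥤ P.Model T) {G : A ⥤ C} {G' : A' ⥤ C}
    (h : k ⋙ P.forget T = G) (h' : k' ⋙ P.forget T = G')
    {s : Profunctor.Square Profunctor.id (P.Φ.obj (op (F.obj universalTheory.X))) G G}
    {s' : Profunctor.Square Profunctor.id (P.Φ.obj (op (F.obj universalTheory.X))) G' G'}
    (hs : HEq ((Profunctor.Square.hid k).vcomp (P.modelCell F e (op universalTheory.X))) s)
    (hs' : HEq ((Profunctor.Square.hid k').vcomp (P.modelCell F e (op universalTheory.X))) s')
    {H : Profunctor.{w} A' A} (t : Profunctor.Square H Profunctor.id G' G)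
    (ht : ∀ (a' : A') (a : A) (x : H.El a a'),
      (P.Φ.obj (op (F.obj universalTheory.X))).cov (t.app a' a x) (s.app a a (𝟙 a)) =
        (P.Φ.obj (op (F.obj universalTheory.X))).con (t.app a' a x) (s'.app a' a' (𝟙 a'))) :
    ∃! σ : Profunctor.Square H Profunctor.id k' k,
      HEq (σ.vcomp (Profunctor.Square.hid (P.forget T))) t := by
  subst h h'
  obtain rfl := eq_of_heq hs
  obtain rfl := eq_of_heq hs'
  have key (a' : A') (a : A) (x : H.El a a') :
      (P.Φ.obj (op T.X)).cov (t.app a' a x) (k.obj a).str =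
        (P.Φ.obj (op T.X)).con (t.app a' a x) (k'.obj a').str := by
    have h₁ := (congrArg ((P.modelCell F e (op universalTheory.X)).app (k.obj a) (k.obj a))
      (k.map_id a)).trans (P.modelCell_point_app_id F e (k.obj a))
    have h₂ := (congrArg ((P.modelCell F e (op universalTheory.X)).app (k'.obj a') (k'.obj a'))
      (k'.map_id a')).trans (P.modelCell_point_app_id F e (k'.obj a'))
    have h₃ := congrArg (Profunctor.happ (P.Φ.map (pointInv F e).op))
      (((congrArg _ h₁).symm.trans (ht a' a x)).trans (congrArg _ h₂))
    refine (congrArg _ (P.happ_pointInv_pointHom F e (k.obj a).str)).symm.trans ?_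
    refine Eq.trans ?_ (congrArg _ (P.happ_pointInv_pointHom F e (k'.obj a').str))
    exact (Profunctor.happ_cov _ _ _).symm.trans (h₃.trans (Profunctor.happ_con _ _ _))
  refine ⟨⟨fun a' a x => (⟨t.app a' a x, key a' a x⟩ : k.obj a ⟶ k'.obj a'), ?_, ?_⟩, ?_, ?_⟩
  · intro a' a'' a f x
    exact Model.Hom.ext (t.app_cov f x)
  · intro a' a b f x
    exact Model.Hom.ext (t.app_con f x)
  · exact HEq.rfl
  · intro σ hσ
    obtain rfl := eq_of_heq hσ
    rfl

theorem existsUnique_modelCone_lift {A : Cat.{w, w}} (c : DoubleCone (modelDiagram F P) A) :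
    ∃! k : A ⟶ Cat.of (P.Model T), (P.modelCone F e).Factors c k := by
  have h := factors_coneLift e c
  refine ⟨(coneLift e c).toCatHom, h, fun k hk => ?_⟩
  have hkF : k.toFunctor ⋙ P.forget T = coneLift e c ⋙ P.forget T :=
    congrArg Cat.Hom.toFunctor (hk.leg ⟨⟨⟩⟩)
  refine Cat.Hom.ext (P.functor_model_ext hkF fun a => ?_)
  refine P.str_heq_of_happ_pointHom F e (Functor.congr_obj hkF a) ?_
  have hs (l : A ⥤ P.Model T) : ((Profunctor.Square.hid l).vcomp
      (P.modelCell F e (op universalTheory.X))).app a a (𝟙 a) =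
      Profunctor.happ (P.Φ.map (pointHom F e).op) (l.obj a).str :=
    (congrArg ((P.modelCell F e (op universalTheory.X)).app (l.obj a) (l.obj a))
      (l.map_id a)).trans (P.modelCell_point_app_id F e (l.obj a))
  refine (heq_of_eq (hs k.toFunctor)).symm.trans (HEq.trans ?_ (heq_of_eq (hs (coneLift e c))))
  exact square_app_heq hkF hkF
    ((hk.cell (i := ⟨⟨⟩⟩) (j := ⟨⟨⟩⟩) (op universalTheory.X)).trans
      (h.cell (i := ⟨⟨⟩⟩) (j := ⟨⟨⟩⟩) (op universalTheory.X)).symm) a a (𝟙 a)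

theorem existsUnique_modelCone_square {A A' : Cat.{w, w}} (c : DoubleCone (modelDiagram F P) A)
    (c' : DoubleCone (modelDiagram F P) A') (k : A ⟶ Cat.of (P.Model T))
    (k' : A' ⟶ Cat.of (P.Model T)) (hk : (P.modelCone F e).Factors c k)
    (hk' : (P.modelCone F e).Factors c' k') (H : Profunctor.{w} A' A)
    (θ : DoubleCone.HorMod c c' H) :
    ∃! σ : Profunctor.Square H Profunctor.id k'.toFunctor k.toFunctor,
      HEq (σ.vcomp (Profunctor.Square.hid (P.forget T))) (θ.app ⟨⟨⟩⟩) :=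
  P.existsUnique_model_square F e k.toFunctor k'.toFunctor
    (congrArg Cat.Hom.toFunctor (hk.leg ⟨⟨⟩⟩)) (congrArg Cat.Hom.toFunctor (hk'.leg ⟨⟨⟩⟩))
    (hk.cell (i := ⟨⟨⟩⟩) (j := ⟨⟨⟩⟩) (op universalTheory.X))
    (hk'.cell (i := ⟨⟨⟩⟩) (j := ⟨⟨⟩⟩) (op universalTheory.X)) (θ.app ⟨⟨⟩⟩)
    fun a' a x =>
      congrArg (fun s : Profunctor.Square H (P.Φ.obj (op (F.obj universalTheory.X)))
          (coneFunctor c') (coneFunctor c) => s.app a' a x)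
        (eq_of_heq (θ.comm (i := ⟨⟨⟩⟩) (j := ⟨⟨⟩⟩) (op universalTheory.X)))

theorem modelCone_isDoubleLimit : (P.modelCone F e).IsDoubleLimit where
  existsUnique_lift c := P.existsUnique_modelCone_lift F e c
  existsUnique_square c c' k k' hk hk' H θ := by
    obtain ⟨σ, hσ, hu⟩ := P.existsUnique_modelCone_square F e c c' k k' hk hk' H θ
    exact ⟨σ, fun _ => hσ, fun τ hτ => hu τ (hτ ⟨⟨⟩⟩)⟩

end Metamodel

/-! ## Monotone maps between finite ordinals, inductively -/

/-- Monotone maps from the ordinal `n` to the ordinal `m`, in normal form. -/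
inductive OrdHom : ℕ → ℕ → Type where
  /-- the identity of the empty ordinal -/
  | nil : OrdHom 0 0
  /-- the top element of the target is not in the image -/
  | skip {n m : ℕ} (f : OrdHom n m) : OrdHom n (m + 1)
  /-- the top element of the source is mapped to the top element of the target -/
  | hit {n m : ℕ} (f : OrdHom n (m + 1)) : OrdHom (n + 1) (m + 1)

namespace OrdHom

/-- The sum of a map with the identity of the one-element ordinal. -/
def succ {n m : ℕ} (f : OrdHom n m) : OrdHom (n + 1) (m + 1) := hit (skip f)

/-- The identity. -/
def id (n : ℕ) : OrdHom n n :=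
  match n with
  | 0 => nil
  | n + 1 => succ (id n)

/-- Postcomposition with `hit g`, in terms of the postcomposition `k` with `g`. -/
def compHit {m p : ℕ} (k : ∀ {n : ℕ}, OrdHom n m → OrdHom n (p + 1)) {n : ℕ}
    (f : OrdHom n (m + 1)) : OrdHom n (p + 1) :=
  match f with
  | skip f => k f
  | hit f => hit (compHit k f)

/-- Composition, with the map applied last as the first argument. -/
def compRev {m p : ℕ} (g : OrdHom m p) {n : ℕ} (f : OrdHom n m) : OrdHom n p :=
  match g with
  | nil => f
  | skip g => skip (compRev g f)
  | hit g => compHit (compRev g) f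

/-- Composition in diagrammatic order. -/
def comp {n m p : ℕ} (f : OrdHom n m) (g : OrdHom m p) : OrdHom n p := compRev g f

theorem comp_skip {n m p : ℕ} (f : OrdHom n m) (g : OrdHom m p) :
    comp f (skip g) = skip (comp f g) := rfl

theorem skip_comp_hit {n m p : ℕ} (f : OrdHom n m) (g : OrdHom m (p + 1)) :
    comp (skip f) (hit g) = comp f g := by
  rw [comp, compRev, compHit]
  rfl

theorem hit_comp_hit {n m p : ℕ} (f : OrdHom n (m + 1)) (g : OrdHom m (p + 1)) :
    comp (hit f) (hit g) = hit (comp f (hit g)) := by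
  rw [comp, comp, compRev, compHit, compRev]

theorem succ_comp_succ {n m p : ℕ} (f : OrdHom n m) (g : OrdHom m p) :
    comp (succ f) (succ g) = succ (comp f g) := by
  rw [succ, succ, hit_comp_hit, skip_comp_hit]
  rfl

theorem id_comp {n m : ℕ} (f : OrdHom n m) : comp (id n) f = f := by
  induction f with
  | nil => rfl
  | skip f ih => exact congrArg skip ih
  | hit f ih => rw [id, succ, hit_comp_hit, skip_comp_hit, ih]

theorem comp_id {n m : ℕ} (f : OrdHom n m) : comp f (id m) = f := by
  induction f with
  | nil => rfl
  | skip f ih => rw [id, succ, skip_comp_hit, comp_skip, ih]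
  | hit f ih => exact (hit_comp_hit _ _).trans (congrArg hit ih)

/-- The sum of two maps. -/
def add {n m : ℕ} (f : OrdHom n m) {n' m' : ℕ} (g : OrdHom n' m') :
    OrdHom (n + n') (m + m') :=
  match g with
  | nil => f
  | skip g => skip (add f g)
  | hit g => hit (add f g)

/-- The associator of the sum. -/
def addAssoc (n m k : ℕ) : OrdHom (n + m + k) (n + (m + k)) :=
  match k with
  | 0 => id _
  | k + 1 => succ (addAssoc n m k)

/-- The inverse of the associator of the sum. -/
def addAssocInv (n m k : ℕ) : OrdHom (n + (m + k)) (n + m + k) :=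
  match k with
  | 0 => id _
  | k + 1 => succ (addAssocInv n m k)

theorem addAssoc_comp_inv (n m k : ℕ) : comp (addAssoc n m k) (addAssocInv n m k) = id _ := by
  induction k with
  | zero => exact id_comp _
  | succ k ih => exact (succ_comp_succ _ _).trans (congrArg succ ih)

theorem addAssocInv_comp (n m k : ℕ) : comp (addAssocInv n m k) (addAssoc n m k) = id _ := by
  induction k with
  | zero => exact id_comp _
  | succ k ih => exact (succ_comp_succ _ _).trans (congrArg succ ih)

/-- The left unitor of the sum. -/
def zeroAdd (n : ℕ) : OrdHom (0 + n) n :=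
  match n with
  | 0 => id _
  | n + 1 => succ (zeroAdd n)

/-- The inverse of the left unitor of the sum. -/
def zeroAddInv (n : ℕ) : OrdHom n (0 + n) :=
  match n with
  | 0 => id _
  | n + 1 => succ (zeroAddInv n)

theorem zeroAdd_comp_inv (n : ℕ) : comp (zeroAdd n) (zeroAddInv n) = id _ := by
  induction n with
  | zero => rfl
  | succ k ih => exact (succ_comp_succ _ _).trans (congrArg succ ih)

theorem zeroAddInv_comp (n : ℕ) : comp (zeroAddInv n) (zeroAdd n) = id _ := by
  induction n with
  | zero => rfl
  | succ k ih => exact (succ_comp_succ _ _).trans (congrArg succ ih)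

section eval

variable {M : Type u} [Category.{v} M] [MonoidalCategory M] (T : Mon M)

/-- The tensor powers of a monoid object. -/
def pow (n : ℕ) : M :=
  match n with
  | 0 => 𝟙_ M
  | n + 1 => pow n ⊗ T.X

/-- The morphism `X ⟶ X ⊗ T` inserting the unit at the end. -/
def insertOne (X : M) : X ⟶ X ⊗ T.X := (ρ_ X).inv ≫ X ◁ MonObj.one

/-- The morphism `X ⊗ T ⊗ T ⟶ X ⊗ T` multiplying the last two factors. -/
def act (X : M) : (X ⊗ T.X) ⊗ T.X ⟶ X ⊗ T.X := (α_ X T.X T.X).hom ≫ X ◁ MonObj.mul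

theorem insertOne_naturality {X Y : M} (f : X ⟶ Y) :
    insertOne T X ≫ f ▷ T.X = f ≫ insertOne T Y := by
  simp [insertOne, whisker_exchange]

theorem act_naturality {X Y : M} (f : X ⟶ Y) :
    act T X ≫ f ▷ T.X = f ▷ T.X ▷ T.X ≫ act T Y := by
  simp [act, whisker_exchange]

theorem insertOne_act (X : M) : insertOne T (X ⊗ T.X) ≫ act T X = 𝟙 _ := by
  simp only [insertOne, act, tensor_whiskerLeft, Category.assoc, Iso.inv_hom_id_assoc]
  rw [← whiskerLeft_comp, MonObj.mul_one]
  monoidal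

theorem insertOne_whisker_act (X : M) : insertOne T X ▷ T.X ≫ act T X = 𝟙 _ := by
  simp only [insertOne, act, comp_whiskerRight, whisker_assoc, Category.assoc,
    Iso.inv_hom_id_assoc]
  rw [← whiskerLeft_comp, MonObj.one_mul]
  monoidal

theorem act_act (X : M) : act T X ▷ T.X ≫ act T X = act T (X ⊗ T.X) ≫ act T X := by
  simp only [act, comp_whiskerRight, whisker_assoc, Category.assoc, Iso.inv_hom_id_assoc,
    tensor_whiskerLeft]
  rw [← whiskerLeft_comp, MonObj.mul_assoc, ← whiskerLeft_comp]
  simp only [whiskerLeft_comp]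
  monoidal

theorem insertOne_whiskerLeft (X Y : M) :
    X ◁ insertOne T Y ≫ (α_ X Y T.X).inv = insertOne T (X ⊗ Y) := by
  simp [insertOne]

theorem act_whiskerLeft (X Y : M) :
    X ◁ act T Y ≫ (α_ X Y T.X).inv =
      (α_ X (Y ⊗ T.X) T.X).inv ≫ (α_ X Y T.X).inv ▷ T.X ≫ act T (X ⊗ Y) := by
  simp [act]

theorem comp_insertOne_act {X Y : M} (f : X ⟶ Y) :
    (f ≫ insertOne T Y) ▷ T.X ≫ act T Y = f ▷ T.X := by
  rw [comp_whiskerRight, Category.assoc, insertOne_whisker_act, Category.comp_id]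

theorem insertOne_comp_act {X Y Z : M} (f : X ⟶ Y) (g : Y ⟶ Z ⊗ T.X) :
    (f ≫ insertOne T Y) ≫ g ▷ T.X ≫ act T Z = f ≫ g := by
  rw [Category.assoc, reassoc_of% insertOne_naturality T g, insertOne_act, Category.comp_id]

theorem act_comp_act {X Y Z : M} (f : X ⟶ Y ⊗ T.X) (g : Y ⟶ Z ⊗ T.X) :
    (f ≫ g ▷ T.X ≫ act T Z) ▷ T.X ≫ act T Z =
      (f ▷ T.X ≫ act T Y) ≫ g ▷ T.X ≫ act T Z := by
  rw [Category.assoc, reassoc_of% act_naturality T g, comp_whiskerRight, comp_whiskerRight, Category.assoc,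
    Category.assoc, act_act]

theorem tensor_insertOne {A B X Y P Q : M} {f : A ⟶ B} {g : X ⟶ Y} {a : A ⊗ X ⟶ P}
    {b : B ⊗ Y ⟶ Q} {h : P ⟶ Q} (e : (f ⊗ₘ g) ≫ b = a ≫ h) :
    (f ⊗ₘ (g ≫ insertOne T Y)) ≫ (α_ _ _ _).inv ≫ b ▷ T.X = a ≫ h ≫ insertOne T Q := by
  rw [← Category.assoc a, ← e, Category.assoc, ← insertOne_naturality T b,
    ← insertOne_whiskerLeft]
  simp [MonoidalCategory.tensorHom_def]

theorem tensor_act {A B X Y P Q : M} {f : A ⟶ B} {g : X ⟶ Y ⊗ T.X} {a : A ⊗ X ⟶ P}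
    {b : B ⊗ Y ⟶ Q} {h : P ⟶ Q ⊗ T.X}
    (e : (f ⊗ₘ g) ≫ (α_ _ _ _).inv ≫ b ▷ T.X = a ≫ h) :
    (f ⊗ₘ (g ▷ T.X ≫ act T Y)) ≫ (α_ _ _ _).inv ≫ b ▷ T.X =
      ((α_ _ _ _).inv ≫ a ▷ T.X) ≫ h ▷ T.X ≫ act T Q := by
  have e' := congrArg (· ▷ T.X) e
  simp only [comp_whiskerRight] at e'
  rw [Category.assoc, ← reassoc_of% e', ← act_naturality]
  simp [MonoidalCategory.tensorHom_def, reassoc_of% act_whiskerLeft T B Y]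

theorem assoc_whiskerRight {A B X P Q R S : M} (Y : M) {a : A ⊗ B ⟶ P} {b : P ⊗ X ⟶ Q}
    {h : Q ⟶ R} {c : B ⊗ X ⟶ S} {d : A ⊗ S ⟶ R}
    (e : a ▷ X ≫ b ≫ h = (α_ _ _ _).hom ≫ A ◁ c ≫ d) :
    a ▷ (X ⊗ Y) ≫ ((α_ _ _ _).inv ≫ b ▷ Y) ≫ h ▷ Y =
      (α_ _ _ _).hom ≫ A ◁ ((α_ _ _ _).inv ≫ c ▷ Y) ≫ (α_ _ _ _).inv ≫ d ▷ Y := by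
  have e' := congrArg (· ▷ Y) e
  simp only [comp_whiskerRight] at e'
  simp [e']

theorem leftUnitor_whiskerRight {X P : M} (Y : M) {b : 𝟙_ M ⊗ X ⟶ P} {h : P ⟶ X}
    (e : b ≫ h = (λ_ X).hom) : ((α_ _ _ _).inv ≫ b ▷ Y) ≫ h ▷ Y = (λ_ (X ⊗ Y)).hom := by
  have e' := congrArg (· ▷ Y) e
  simp only [comp_whiskerRight] at e'
  simp [e']

/-- The action of a monotone map on tensor powers of a monoid object. -/
def eval {n m : ℕ} (f : OrdHom n m) : pow T n ⟶ pow T m :=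
  match f with
  | nil => 𝟙 _
  | skip f => eval f ≫ insertOne T _
  | hit f => eval f ▷ T.X ≫ act T _

theorem eval_skip {n m : ℕ} (f : OrdHom n m) : eval T (skip f) = eval T f ≫ insertOne T _ := rfl

theorem eval_hit {n m : ℕ} (f : OrdHom n (m + 1)) :
    eval T (hit f) = eval T f ▷ T.X ≫ act T (pow T m) := rfl

theorem eval_succ {n m : ℕ} (f : OrdHom n m) : eval T (succ f) = eval T f ▷ T.X :=
  comp_insertOne_act T (eval T f)

theorem eval_id (n : ℕ) : eval T (id n) = 𝟙 _ := by
  induction n with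
  | zero => rfl
  | succ n ih =>
    rw [id, eval_succ, ih]
    exact id_whiskerRight _ _

theorem eval_comp {n m p : ℕ} (f : OrdHom n m) (g : OrdHom m p) :
    eval T (comp f g) = eval T f ≫ eval T g := by
  match f, g with
  | f, nil => exact (Category.comp_id _).symm
  | f, skip g =>
    rw [comp_skip, eval_skip, eval_skip, eval_comp f g]
    exact Category.assoc _ _ _
  | skip f, hit g =>
    rw [skip_comp_hit, eval_comp f g]
    exact (insertOne_comp_act T (eval T f) (eval T g)).symm
  | hit f, hit g =>
    rw [hit_comp_hit, eval_hit, eval_comp f (hit g)]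
    exact act_comp_act T (eval T f) (eval T g)

/-- The comparison between tensor powers and addition. -/
def powAdd (n k : ℕ) : pow T n ⊗ pow T k ≅ pow T (n + k) :=
  match k with
  | 0 => ρ_ _
  | k + 1 => (α_ _ _ _).symm ≪≫ whiskerRightIso (powAdd n k) T.X

theorem eval_add {n m n' m' : ℕ} (f : OrdHom n m) (g : OrdHom n' m') :
    (eval T f ⊗ₘ eval T g) ≫ (powAdd T m m').hom = (powAdd T n n').hom ≫ eval T (add f g) := by
  induction g with
  | nil =>
    exact (congrArg (· ≫ _) (MonoidalCategory.tensorHom_id (eval T f) (𝟙_ M))).trans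
      (rightUnitor_naturality (eval T f))
  | skip g ih => exact tensor_insertOne T ih
  | hit g ih => exact tensor_act T ih

theorem eval_addAssoc (n m k : ℕ) :
    (powAdd T n m).hom ▷ pow T k ≫ (powAdd T (n + m) k).hom ≫ eval T (addAssoc n m k) =
      (α_ _ _ _).hom ≫ pow T n ◁ (powAdd T m k).hom ≫ (powAdd T n (m + k)).hom := by
  induction k with
  | zero =>
    rw [addAssoc, eval_id, Category.comp_id]
    exact (rightUnitor_naturality (powAdd T n m).hom).trans
      ((congrArg (· ≫ _) (rightUnitor_tensor_hom (pow T n) (pow T m))).trans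
        (Category.assoc _ _ _))
  | succ k ih =>
    rw [addAssoc, eval_succ]
    exact assoc_whiskerRight T.X ih

theorem eval_zeroAdd (n : ℕ) :
    (powAdd T 0 n).hom ≫ eval T (zeroAdd n) = (λ_ (pow T n)).hom := by
  induction n with
  | zero => exact (Category.comp_id _).trans unitors_equal.symm
  | succ n ih =>
    rw [zeroAdd, eval_succ]
    exact leftUnitor_whiskerRight T.X ih

end eval

end OrdHom

/-! ## Morphisms to an ordinal with a new top element -/

namespace AugmentedSimplexCategory

theorem hom_star_ext {x : AugmentedSimplexCategory} (f g : WithInitial.star ⟶ x) : f = g :=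
  WithInitial.starInitial.hom_ext f g

theorem isEmpty_tensor_point_hom_star (x : AugmentedSimplexCategory) :
    IsEmpty (x ⊗ universalTheory.X ⟶ WithInitial.star) :=
  match x with
  | .of _ => ⟨fun f => PEmpty.elim f⟩
  | .star => ⟨fun f => PEmpty.elim f⟩

theorem inl_apply (x y : SimplexCategory) (i : Fin (x.len + 1)) :
    ((inl' x y).toOrderHom i : ℕ) = i := by
  rw [inl'_eval]
  simp

theorem inr_apply (x y : SimplexCategory) (i : Fin (y.len + 1)) :
    ((inr' x y).toOrderHom i : ℕ) = x.len + 1 + i := by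
  rw [inr'_eval]
  simp

theorem inl_point_cancel {x y : AugmentedSimplexCategory} {f g : x ⟶ y}
    (h : f ≫ inl y universalTheory.X = g ≫ inl y universalTheory.X) : f = g :=
  match x, y, f, g, h with
  | .star, _, _, _, _ => hom_star_ext _ _
  | .of _, .star, f, _, _ => PEmpty.elim f
  | .of x, .of y, f, g, h => by
    change x ⟶ y at f g
    change f ≫ inl' y ⦋0⦌ = g ≫ inl' y ⦋0⦌ at h
    ext i
    have h' := congrArg (fun t : x ⟶ tensorObjOf y ⦋0⦌ => (t.toOrderHom i : ℕ)) h
    change ((inl' y ⦋0⦌).toOrderHom (f.toOrderHom i) : ℕ) =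
      (inl' y ⦋0⦌).toOrderHom (g.toOrderHom i) at h'
    rw [inl_apply, inl_apply] at h'
    exact h'

theorem comp_inl_ne_inr {y : AugmentedSimplexCategory} (f : universalTheory.X ⟶ y) :
    f ≫ inl y universalTheory.X ≠ inr y universalTheory.X :=
  match y, f with
  | .star, f => PEmpty.elim f
  | .of y, f => fun h => by
    change ⦋0⦌ ⟶ y at f
    change f ≫ inl' y ⦋0⦌ = inr' y ⦋0⦌ at h
    have h' := congrArg (fun t : ⦋0⦌ ⟶ tensorObjOf y ⦋0⦌ => (t.toOrderHom 0 : ℕ)) h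
    change ((inl' y ⦋0⦌).toOrderHom (f.toOrderHom 0) : ℕ) = (inr' y ⦋0⦌).toOrderHom 0 at h'
    rw [inl_apply, inr_apply] at h'
    have := (f.toOrderHom 0).isLt
    omega

/-- A monotone map whose values avoid the top element factors through the inclusion. -/
theorem exists_comp_inl {x y : SimplexCategory} (f : x ⟶ tensorObjOf y ⦋0⦌)
    (h : ∀ i, (f.toOrderHom i : ℕ) < y.len + 1) : ∃ g : x ⟶ y, f = g ≫ inl' y ⦋0⦌ := by
  refine ⟨SimplexCategory.mkHom ⟨fun i => ⟨f.toOrderHom i, h i⟩, fun i j hij => ?_⟩, ?_⟩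
  · exact f.toOrderHom.monotone hij
  · ext i
    exact (inl_apply y ⦋0⦌ ⟨f.toOrderHom i, h i⟩).symm

theorem lt_or_eq_top {x y : SimplexCategory} (f : x ⟶ tensorObjOf y ⦋0⦌) :
    (∀ i, (f.toOrderHom i : ℕ) < y.len + 1) ∨
      (f.toOrderHom (Fin.last _) : ℕ) = y.len + 1 := by
  by_cases h : (f.toOrderHom (Fin.last _) : ℕ) < y.len + 1
  · exact .inl fun i => lt_of_le_of_lt (f.toOrderHom.monotone (Fin.le_last i)) h
  · have := (f.toOrderHom (Fin.last _)).isLt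
    simp only [SimplexCategory.len_mk] at this
    exact .inr (by omega)

theorem factors_inl_or_inr_comp {x y : AugmentedSimplexCategory}
    (f : x ⊗ universalTheory.X ⟶ y ⊗ universalTheory.X) :
    (∃ g, f = g ≫ inl y universalTheory.X) ∨
      inr x universalTheory.X ≫ f = inr y universalTheory.X :=
  match x, y, f with
  | _, .star, _ => .inr (hom_point_ext _ _)
  | .star, .of y, f => by
    change ⦋0⦌ ⟶ tensorObjOf y ⦋0⦌ at f
    obtain h | h := lt_or_eq_top f
    · obtain ⟨g, hg⟩ := exists_comp_inl f h
      exact .inl ⟨g, hg⟩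
    · refine .inr (Eq.trans ((congrArg (· ≫ (show universalTheory.X ⟶ .of y ⊗
        universalTheory.X from f)) (hom_point_ext (inr .star universalTheory.X)
          (𝟙 universalTheory.X))).trans (Category.id_comp _)) ?_)
      change f = inr' y ⦋0⦌
      ext i
      rw [inr_apply]
      have : i = 0 := (inferInstance : Subsingleton (Fin 1)).elim i 0
      subst this
      exact h
  | .of x, .of y, f => by
    change tensorObjOf x ⦋0⦌ ⟶ tensorObjOf y ⦋0⦌ at f
    obtain h | h := lt_or_eq_top f
    · obtain ⟨g, hg⟩ := exists_comp_inl f h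
      exact .inl ⟨g, hg⟩
    · refine .inr ?_
      change inr' x ⦋0⦌ ≫ f = inr' y ⦋0⦌
      ext i
      rw [inr_apply]
      have : i = 0 := (inferInstance : Subsingleton (Fin 1)).elim i 0
      subst this
      refine Eq.trans ?_ h
      change (f.toOrderHom ((inr' x ⦋0⦌).toOrderHom 0) : ℕ) = _
      congr 2

theorem inr_act (x : AugmentedSimplexCategory) :
    inr (x ⊗ universalTheory.X) universalTheory.X ≫ OrdHom.act universalTheory x =
      inr x universalTheory.X := by
  rw [OrdHom.act, inr_comp_associator_assoc, ← MonoidalCategory.id_tensorHom,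
    inr_comp_tensorHom, ← Category.assoc]
  exact (congrArg (· ≫ _) (hom_point_ext _ (𝟙 _))).trans (Category.id_comp _)

theorem inr_whiskerRight_act {x y : AugmentedSimplexCategory}
    (f : x ⟶ y ⊗ universalTheory.X) : inr x universalTheory.X ≫ f ▷ universalTheory.X ≫
      OrdHom.act universalTheory y = inr y universalTheory.X := by
  rw [← MonoidalCategory.tensorHom_id, inr_comp_tensorHom_assoc, inr_act, Category.id_comp]

theorem inl_whiskerRight_act {x y : AugmentedSimplexCategory}
    (f : x ⟶ y ⊗ universalTheory.X) : inl x universalTheory.X ≫ f ▷ universalTheory.X ≫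
      OrdHom.act universalTheory y = f := by
  have := OrdHom.insertOne_comp_act universalTheory (𝟙 x) f
  rwa [Category.id_comp, Category.id_comp] at this

end AugmentedSimplexCategory

namespace OrdHom

theorem eval_universalTheory_injective {n m : ℕ} {f g : OrdHom n m}
    (h : eval universalTheory f = eval universalTheory g) : f = g := by
  induction f with
  | nil =>
    cases g
    rfl
  | skip f ih =>
    cases g with
    | skip g => exact congrArg skip (ih (inl_point_cancel h))
    | hit g =>
      have h' := (congrArg (inr _ universalTheory.X ≫ ·) h).trans
        (inr_whiskerRight_act (eval universalTheory g))
      exact (comp_inl_ne_inr _ ((Category.assoc _ _ _).trans h')).elim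
  | hit f ih =>
    cases g with
    | skip g =>
      have h' := (congrArg (inr _ universalTheory.X ≫ ·) h).symm.trans
        (inr_whiskerRight_act (eval universalTheory f))
      exact (comp_inl_ne_inr _ ((Category.assoc _ _ _).trans h')).elim
    | hit g =>
      refine congrArg hit (ih ?_)
      exact (inl_whiskerRight_act (eval universalTheory f)).symm.trans
        ((congrArg (inl _ universalTheory.X ≫ ·) h).trans
          (inl_whiskerRight_act (eval universalTheory g)))

theorem eval_universalTheory_surjective (n m : ℕ)
    (f : pow universalTheory n ⟶ pow universalTheory m) :
    ∃ p : OrdHom n m, eval universalTheory p = f := by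
  match n, m, f with
  | 0, 0, f => exact ⟨nil, hom_star_ext _ _⟩
  | n + 1, 0, f => exact (isEmpty_tensor_point_hom_star _).elim f
  | 0, m + 1, f =>
    obtain ⟨p, -⟩ := eval_universalTheory_surjective 0 m (WithInitial.starInitial.to _)
    exact ⟨skip p, hom_star_ext _ _⟩
  | n + 1, m + 1, f =>
    obtain ⟨g, hg⟩ | h := factors_inl_or_inr_comp f
    · obtain ⟨p, hp⟩ := eval_universalTheory_surjective (n + 1) m g
      exact ⟨skip p, (congrArg (· ≫ inl _ universalTheory.X) hp).trans hg.symm⟩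
    · obtain ⟨p, hp⟩ := eval_universalTheory_surjective n (m + 1) (inl _ universalTheory.X ≫ f)
      refine ⟨hit p, tensorObj_hom_ext _ _ ?_ ?_⟩
      · exact (inl_whiskerRight_act (eval universalTheory p)).trans hp
      · exact (inr_whiskerRight_act (eval universalTheory p)).trans h.symm

theorem exists_pow_universalTheory (x : AugmentedSimplexCategory) :
    ∃ n, pow universalTheory n = x := by
  have h (n : ℕ) : pow universalTheory (n + 1) = WithInitial.of ⦋n⦌ := by
    induction n with
    | zero => rfl
    | succ n ih => exact congrArg (· ⊗ universalTheory.X) ih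
  match x with
  | .star => exact ⟨0, rfl⟩
  | .of x => exact ⟨x.len + 1, h x.len⟩

end OrdHom

/-! ## The skeletal category of finite ordinals -/

/-- The category of natural numbers and monotone maps in normal form. -/
structure OrdSkeleton where
  /-- the number of elements -/
  card : ℕ

namespace OrdSkeleton

open OrdHom

instance : Category OrdSkeleton where
  Hom x y := OrdHom x.card y.card
  id x := OrdHom.id x.card
  comp f g := OrdHom.comp f g
  id_comp f := OrdHom.id_comp f
  comp_id f := OrdHom.comp_id f
  assoc f g h := eval_universalTheory_injective (by
    simp only [eval_comp]
    exact Category.assoc _ _ _)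

instance : MonoidalCategoryStruct OrdSkeleton where
  tensorObj x y := ⟨x.card + y.card⟩
  tensorUnit := ⟨0⟩
  tensorHom f g := OrdHom.add f g
  whiskerLeft x _ _ g := OrdHom.add (OrdHom.id x.card) g
  whiskerRight f y := OrdHom.add f (OrdHom.id y.card)
  associator x y z :=
    { hom := addAssoc x.card y.card z.card
      inv := addAssocInv x.card y.card z.card
      hom_inv_id := addAssoc_comp_inv _ _ _
      inv_hom_id := addAssocInv_comp _ _ _ }
  leftUnitor x :=
    { hom := zeroAdd x.card
      inv := zeroAddInv x.card
      hom_inv_id := zeroAdd_comp_inv _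
      inv_hom_id := zeroAddInv_comp _ }
  rightUnitor x := Iso.refl x

section

variable {M : Type u} [Category.{v} M] [MonoidalCategory M] (T : Mon M)

/-- The functor of tensor powers of a monoid object. -/
def powFunctor : OrdSkeleton ⥤ M where
  obj x := pow T x.card
  map f := eval T f
  map_id x := eval_id T x.card
  map_comp f g := eval_comp T f g

/-- The comparison isomorphism of the functor of tensor powers. -/
def powμ (x y : OrdSkeleton) :
    (powFunctor T).obj x ⊗ (powFunctor T).obj y ≅ (powFunctor T).obj (x ⊗ y) :=
  powAdd T x.card y.card

theorem powFunctor_map_tensorHom {x x' y y' : OrdSkeleton} (f : x ⟶ x') (g : y ⟶ y') :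
    ((powFunctor T).map f ⊗ₘ (powFunctor T).map g) ≫ (powμ T x' y').hom =
      (powμ T x y).hom ≫ (powFunctor T).map (f ⊗ₘ g) :=
  eval_add T f g

theorem powFunctor_map_whiskerLeft (x : OrdSkeleton) {y y' : OrdSkeleton} (g : y ⟶ y') :
    ((powFunctor T).obj x ◁ (powFunctor T).map g) ≫ (powμ T x y').hom =
      (powμ T x y).hom ≫ (powFunctor T).map (x ◁ g) := by
  rw [← MonoidalCategory.id_tensorHom, ← (powFunctor T).map_id]
  exact eval_add T (OrdHom.id x.card) g

theorem powFunctor_map_whiskerRight {x x' : OrdSkeleton} (f : x ⟶ x') (y : OrdSkeleton) :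
    ((powFunctor T).map f ▷ (powFunctor T).obj y) ≫ (powμ T x' y).hom =
      (powμ T x y).hom ≫ (powFunctor T).map (f ▷ y) := by
  rw [← MonoidalCategory.tensorHom_id, ← (powFunctor T).map_id]
  exact eval_add T f (OrdHom.id y.card)

theorem powFunctor_map_associator (x y z : OrdSkeleton) :
    (powμ T x y).hom ▷ (powFunctor T).obj z ≫ (powμ T (x ⊗ y) z).hom ≫
        (powFunctor T).map (α_ x y z).hom =
      (α_ _ _ _).hom ≫ (powFunctor T).obj x ◁ (powμ T y z).hom ≫ (powμ T x (y ⊗ z)).hom :=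
  eval_addAssoc T x.card y.card z.card

theorem powFunctor_map_leftUnitor (x : OrdSkeleton) :
    (powμ T (𝟙_ _) x).hom ≫ (powFunctor T).map (λ_ x).hom = (λ_ ((powFunctor T).obj x)).hom :=
  eval_zeroAdd T x.card

theorem powFunctor_map_rightUnitor (x : OrdSkeleton) :
    (powμ T x (𝟙_ _)).hom ≫ (powFunctor T).map (ρ_ x).hom = (ρ_ ((powFunctor T).obj x)).hom :=
  (congrArg _ ((powFunctor T).map_id x)).trans (Category.comp_id _)

end

instance : (powFunctor universalTheory).Faithful where
  map_injective h := eval_universalTheory_injective h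

instance : (powFunctor universalTheory).Full where
  map_surjective f := eval_universalTheory_surjective _ _ f

instance : (powFunctor universalTheory).EssSurj where
  mem_essImage x :=
    let ⟨n, hn⟩ := exists_pow_universalTheory x
    ⟨⟨n⟩, ⟨eqToIso hn⟩⟩

instance : (powFunctor universalTheory).IsEquivalence where

instance : MonoidalCategory OrdSkeleton :=
  Monoidal.induced (powFunctor universalTheory)
    { μIso := powμ universalTheory
      εIso := Iso.refl _
      whiskerLeft_eq x _ _ g := by
        rw [Iso.eq_inv_comp, powFunctor_map_whiskerLeft]
      whiskerRight_eq f y := by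
        rw [Iso.eq_inv_comp, powFunctor_map_whiskerRight]
      tensorHom_eq f g := by
        rw [Iso.eq_inv_comp, powFunctor_map_tensorHom]
      associator_eq x y z := by
        have h := powFunctor_map_associator universalTheory x y z
        rw [← cancel_epi (powμ universalTheory (x ⊗ y) z).hom,
          ← cancel_epi ((powμ universalTheory x y).hom ▷ (powFunctor universalTheory).obj z), h]
        simp
      leftUnitor_eq x := by
        rw [← cancel_epi (powμ universalTheory (𝟙_ _) x).hom, powFunctor_map_leftUnitor]
        simp only [Iso.trans_hom, Iso.symm_hom, Category.assoc, Iso.hom_inv_id_assoc]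
        exact (Category.id_comp _).symm.trans (congrArg (· ≫ _) (id_whiskerRight _ _).symm)
      rightUnitor_eq x := by
        rw [← cancel_epi (powμ universalTheory x (𝟙_ _)).hom, powFunctor_map_rightUnitor]
        simp only [Iso.trans_hom, Iso.symm_hom, Category.assoc, Iso.hom_inv_id_assoc]
        exact (Category.id_comp _).symm.trans (congrArg (· ≫ _) (whiskerLeft_id _ _).symm) }

section

variable {M : Type u} [Category.{v} M] [MonoidalCategory M] (T : Mon M)

instance : (powFunctor T).Monoidal :=
  Functor.CoreMonoidal.toMonoidal
    { εIso := Iso.refl _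
      μIso := powμ T
      μIso_hom_natural_left f y := powFunctor_map_whiskerRight T f y
      μIso_hom_natural_right x g := powFunctor_map_whiskerLeft T x g
      associativity x y z := powFunctor_map_associator T x y z
      left_unitality x :=
        (powFunctor_map_leftUnitor T x).symm.trans ((Category.id_comp _).symm.trans
          (congrArg (· ≫ _) (id_whiskerRight _ _).symm))
      right_unitality x :=
        (powFunctor_map_rightUnitor T x).symm.trans ((Category.id_comp _).symm.trans
          (congrArg (· ≫ _) (whiskerLeft_id _ _).symm)) }

end

theorem hom_one_ext {x : OrdSkeleton} (f g : x ⟶ ⟨1⟩) : f = g :=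
  (powFunctor universalTheory).map_injective (hom_point_ext _ _)

/-- The one-element ordinal as a monoid object. -/
def point : Mon OrdSkeleton where
  X := ⟨1⟩
  mon :=
    { one := skip nil
      mul := hit (hit (skip nil))
      one_mul := hom_one_ext _ _
      mul_one := hom_one_ext _ _
      mul_assoc := hom_one_ext _ _ }

theorem eval_point_one {M : Type u} [Category.{v} M] [MonoidalCategory M] (T : Mon M) :
    (𝟙 (𝟙_ M) ≫ insertOne T (𝟙_ M)) ≫ (λ_ T.X).hom = MonObj.one := by
  simp [insertOne, unitors_equal]

theorem eval_point_mul {M : Type u} [Category.{v} M] [MonoidalCategory M] (T : Mon M) :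
    ((α_ (𝟙_ M ⊗ T.X) (𝟙_ M) T.X).inv ≫ (ρ_ (𝟙_ M ⊗ T.X)).hom ▷ T.X) ≫
      (((𝟙 (𝟙_ M) ≫ insertOne T (𝟙_ M)) ▷ T.X ≫ act T (𝟙_ M)) ▷ T.X ≫ act T (𝟙_ M)) ≫
        (λ_ T.X).hom = ((λ_ T.X).hom ⊗ₘ (λ_ T.X).hom) ≫ MonObj.mul := by
  rw [comp_insertOne_act, id_whiskerRight, id_whiskerRight, Category.id_comp]
  simp only [act, Category.assoc, leftUnitor_naturality]
  monoidal

/-- Every monoid object is the image of the one-element ordinal. -/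
def powFunctorPoint {M : Type u} [Category.{v} M] [MonoidalCategory M] (T : Mon M) :
    (powFunctor T).mapMon.obj point ≅ T :=
  Mon.mkIso (λ_ T.X)
    ((congrArg (· ≫ _) (Category.id_comp _)).trans (eval_point_one T))
    ((Category.assoc _ _ _).trans (eval_point_mul T))

/-- The powers of the universal theory exhibit the ordinals as a skeleton. -/
noncomputable def ordEquivalence : OrdSkeleton ≌ AugmentedSimplexCategory :=
  (powFunctor universalTheory).asEquivalence

noncomputable instance : ordEquivalence.functor.Monoidal :=
  (inferInstance : (powFunctor universalTheory).Monoidal)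

end OrdSkeleton

/-- Transport of a monoidal functor along a monoidal equivalence. -/
theorem exists_monoidal_of_equivalence {M : Type u} [Category.{v} M] [MonoidalCategory M]
    {D : Type u₁} [Category.{v₁} D] [MonoidalCategory D] {D' : Type u₂} [Category.{v₂} D']
    [MonoidalCategory D'] (E : D ≌ D') [E.functor.Monoidal] (G : D ⥤ M) [G.Monoidal]
    {p : Mon D} {q : Mon D'} {T : Mon M} (i : E.functor.mapMon.obj p ≅ q)
    (j : G.mapMon.obj p ≅ T) :
    ∃ (F : D' ⥤ M) (_ : F.Monoidal), Nonempty (F.mapMon.obj q ≅ T) := by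
  let := E.inverseMonoidal
  have : E.IsMonoidal := Adjunction.instIsMonoidal E.toAdjunction
  exact ⟨E.inverse ⋙ G, inferInstance, ⟨Functor.mapMonCompIso.app _ ≪≫
    G.mapMon.mapIso (E.inverse.mapMon.mapIso i.symm ≪≫ (E.mapMon.unitIso.app p).symm) ≪≫ j⟩⟩

theorem exists_monoidal_mapMon_universalTheory_iso {M : Type u} [Category.{v} M]
    [MonoidalCategory M] (T : Mon M) :
    ∃ (F : AugmentedSimplexCategory ⥤ M) (_ : F.Monoidal),
      Nonempty (F.mapMon.obj universalTheory ≅ T) :=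
  exists_monoidal_of_equivalence OrdSkeleton.ordEquivalence (OrdSkeleton.powFunctor T)
    (OrdSkeleton.powFunctorPoint universalTheory) (OrdSkeleton.powFunctorPoint T)

theorem mainTheorem3 {M : Type u} [Category.{v} M] [MonoidalCategory M] (T : Mon M)
    {C : Type w} [Category.{w} C] (P : Metamodel M C) :
    (∃ (F : AugmentedSimplexCategory ⥤ M) (_ : F.Monoidal),
      Nonempty (F.mapMon.obj universalTheory ≅ T)) ∧
    ∀ (F : AugmentedSimplexCategory ⥤ M) [F.Monoidal] (e : F.mapMon.obj universalTheory ≅ T),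
      ∃ c : DoubleCone (modelDiagram F P) (Cat.of (P.Model T)),
        c.IsDoubleLimit ∧
        c.leg ⟨⟨⟩⟩ = (P.forget T).toCatHom ∧
        HEq (c.cell (i := ⟨⟨⟩⟩) (j := ⟨⟨⟩⟩) (op universalTheory.X))
          (Profunctor.Square.vcomp (P.modelSq T) (P.mapSq e.hom.hom.op)) := by
  refine ⟨exists_monoidal_mapMon_universalTheory_iso T, fun F _ e => ?_⟩
  exact ⟨P.modelCone F e, P.modelCone_isDoubleLimit F e, rfl,
    heq_of_eq (P.modelCone_cell_point F e)⟩
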